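/- Let $(\Omega,\mu)$ be a $\sigma$-finite measure space with a non-atomic measure such that $\mu(\Omega)=\infty$ (for instance $(0,\infty)$ with Lebesgue measure). Let $\mathfrak M(\Omega,\mu)$ be the space of complex-valued, measurable, a.e. finite functions on $\Omega$ (modulo a.e. equality), write $\mathfrak M(0,\infty)$ for the case of Lebesgue measure on $(0,\infty)$, and let $f^*(t)=\inf\{\lambda>0:\mu\{|f|>\lambda\}\le t\}$, $t>0$, be the non-increasing rearrangement of $f$. Let $E$ be a rearrangement-invariant quasi-Banach function space over $(\Omega,\mu)$: there is a quasi-norm $\rho_E:\mathfrak M(0,\infty)\to[0,\infty]$ such that (a) $|g|\le|f|$ a.e. implies $\rho_E(g)\le\rho_E(f)$; (b) $0\le f_n\nearrow f$ a.e. implies $\rho_E(f_n)\nearrow\rho_E(f)$; (c) $\rho_E(\chi_\omega)<\infty$ for every measurable $\omega\subset(0,\infty)$ of finite measure; and $E=\{f\in\mathfrak M(\Omega,\mu):\rho_E(f^*)<\infty\}$ is a quasi-Banach space with the quasi-norm $\|f\|_E=\rho_E(f^*)$ (where $\rho_E(g)=\infty$ if $g$ is not a.e. finite). For $a>0$ let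 $\|D_a\|$ be the operator norm of $(D_af)(t)=f(at)$ on the space $\{f\in\mathfrak M(0,\infty):\rho_E(f^*)<\infty\}$ with the quasi-norm $\rho_E(f^*)$, and let the Boyd indices of $E$ be $$p_E=\sup\{p>0:\exists c>0\ \forall\,0<a<1\ \ \|D_a\|\le c\,a^{-1/p}\},\qquad q_E=\inf\{q>0:\exists c>0\ \forall a\ge1\ \ \|D_a\|\le c\,a^{-1/q}\},$$ with $p,q$ finite and $\inf\emptyset=\infty$. For $0<p,q\le\infty$ let $L_{p,q}=L_{p,q}(\Omega,\mu)$ be the Lorentz space of all $f\in\mathfrak M(\Omega,\mu)$ with finite quasi-norm $\|f\|_{p,q}=\big(\int_0^\infty (t^{1/p-1/q}f^*(t))^q\,dt\big)^{1/q}$ if $q<\infty$, and $\|f\|_{p,\infty}=\sup_{t>0}t^{1/p}f^*(t)$ (with $1/\infty=0$). For a couple $(X_0,X_1)$ of such spaces, $0<\Theta,r<\infty$, and $K(t,x)=\inf\{\|x_0\|_{X_0}+t\|x_1\|_{X_1}:x=x_0+x_1,\ x_i\in X_i\}$, let $(X_0,X_1)_{\Theta,r;E}$ be the space of all $x\in X_0+X_1$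 with $$\|x\|_{(X_0,X_1)_{\Theta,r;E}}=\rho_E\big(t^{-1/r}K(t^{1/\Theta},x)\big)<\infty .$$ Let $0<p_0<p_1\le\infty$, $0<q_0,q_1\le\infty$ and $p_0<p_E$. Assume that either (i) $q_E<p_1<\infty$ and $\frac1\Theta=\frac1{p_0}-\frac1{p_1}$, or (ii) $p_1=q_1=\infty$ and $\Theta=p_0$ (here $q_E=\infty$ is allowed). Then $(L_{p_0,q_0},L_{p_1,q_1})_{\Theta,p_0;E}=E$, that is, the two spaces consist of the same functions and their quasi-norms are equivalent: there is a constant $C<\infty$, independent of $f$, such that $\|f\|_{(L_{p_0,q_0},L_{p_1,q_1})_{\Theta,p_0;E}}\le C\|f\|_E$ and $\|f\|_E\le C\|f\|_{(L_{p_0,q_0},L_{p_1,q_1})_{\Theta,p_0;E}}$ for all $f\in E$. -/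

import Mathlib

open MeasureTheory Set Filter Topology
open scoped ENNReal NNReal ComplexOrder

noncomputable section

/-! ### Quasi-norms with values in `[0, ∞]`

A quasi-normed space `X` sitting inside a vector space `V` is given by an extended quasi-norm
`N : V → [0, ∞]`; the space itself is `X = {v | N v < ∞}`. -/

/-- `N` is a quasi-norm (possibly taking the value `∞`) on the complex vector space `V`. -/
structure IsQuasiNorm {V : Type*} [AddCommGroup V] [Module ℂ V] (N : V → ℝ≥0∞) : Prop where
  eq_zero_iff : ∀ v : V, N v = 0 ↔ v = 0
  smul : ∀ (c : ℂ) (v : V), N (c • v) = ‖c‖ₑ * N v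
  add_le : ∃ C : ℝ≥0, ∀ v w : V, N (v + w) ≤ C * (N v + N w)

/-- Every `N`-Cauchy sequence in `{v | N v < ∞}` converges in `{v | N v < ∞}`. -/
def IsCompleteFor {V : Type*} [AddCommGroup V] (N : V → ℝ≥0∞) : Prop :=
  ∀ u : ℕ → V, (∀ n, N (u n) < ∞) →
    (∀ ε : ℝ≥0∞, 0 < ε → ∃ n₀ : ℕ, ∀ m ≥ n₀, ∀ n ≥ n₀, N (u m - u n) < ε) →
    ∃ v : V, N v < ∞ ∧ Tendsto (fun n => N (u n - v)) atTop (𝓝 0)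

/-! ### Measurable functions and the non-increasing rearrangement -/

/-- A measure without atoms: every measurable set of positive measure splits into two measurable
sets of positive measure. (Mathlib's `NoAtoms` only asks that points are null.) -/
def NonAtomic {Ω : Type*} [MeasurableSpace Ω] (μ : Measure Ω) : Prop :=
  ∀ A : Set Ω, MeasurableSet A → μ A ≠ 0 →
    ∃ B ⊆ A, MeasurableSet B ∧ μ B ≠ 0 ∧ μ (A \ B) ≠ 0

/-- Lebesgue measure on `(0, ∞)`. -/
abbrev halfLine : Measure ℝ := volume.restrict (Ioi 0)

/-- `𝔐(0, ∞)`: complex-valued Lebesgue measurable functions on `(0, ∞)` up to a.e. equality. -/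
abbrev MHalfLine : Type := ℝ →ₘ[halfLine] ℂ

/-- The non-increasing rearrangement
`f^*(t) = inf {s | μ {x | |f x| > s} ≤ t}`, with value `∞` if there is no such finite `s`. -/
def rearr {Ω : Type*} [MeasurableSpace Ω] (μ : Measure Ω) (f : Ω →ₘ[μ] ℂ) (t : ℝ) : ℝ≥0∞ :=
  sInf {s : ℝ≥0∞ | μ {x | s < ‖f x‖ₑ} ≤ ENNReal.ofReal t}

/-- The value of `ρ` at a function `g : (0, ∞) → [0, ∞]`: it is `ρ F` if `g = |F|` a.e. with
`F ∈ 𝔐(0, ∞)` (for `ρ` with the lattice property the choice of `F` is immaterial), and it is `∞`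
if there is no such `F`, in particular if `g` is infinite on a set of positive measure. -/
def evalNonneg (ρ : MHalfLine → ℝ≥0∞) (g : ℝ → ℝ≥0∞) : ℝ≥0∞ :=
  ⨅ (F : MHalfLine) (_ : ∀ᵐ t ∂halfLine, g t = ‖F t‖ₑ), ρ F

/-! ### Rearrangement-invariant quasi-Banach function spaces -/

/-- The quasi-norm `‖f‖_E = ρ(f^*)` on functions on `(Ω, μ)`. -/
def riNorm {Ω : Type*} [MeasurableSpace Ω] (μ : Measure Ω) (ρ : MHalfLine → ℝ≥0∞)
    (f : Ω →ₘ[μ] ℂ) : ℝ≥0∞ :=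
  evalNonneg ρ (rearr μ f)

/-- The space `E = {f | ρ(f^*) < ∞}` of functions on `(Ω, μ)`. -/
def riSpace {Ω : Type*} [MeasurableSpace Ω] (μ : Measure Ω) (ρ : MHalfLine → ℝ≥0∞) :
    Set (Ω →ₘ[μ] ℂ) :=
  {f | riNorm μ ρ f < ∞}

/-- `E = {f | ρ(f^*) < ∞}` with `‖f‖_E = ρ(f^*)` is a rearrangement-invariant quasi-Banach function
space over `(Ω, μ)`, where `ρ` is a lattice quasi-norm on `𝔐(0, ∞)` with the Fatou property. -/
structure IsRIQuasiBanach {Ω : Type*} [MeasurableSpace Ω] (μ : Measure Ω)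
    (ρ : MHalfLine → ℝ≥0∞) : Prop where
  quasiNorm : IsQuasiNorm ρ
  lattice : ∀ f g : MHalfLine, (∀ᵐ t ∂halfLine, ‖g t‖ ≤ ‖f t‖) → ρ g ≤ ρ f
  fatou : ∀ (F : ℕ → MHalfLine) (f : MHalfLine),
    (∀ᵐ t ∂halfLine, (∀ n, 0 ≤ F n t) ∧ Monotone (fun n => F n t) ∧
      Tendsto (fun n => F n t) atTop (𝓝 (f t))) →
    Monotone (fun n => ρ (F n)) ∧ Tendsto (fun n => ρ (F n)) atTop (𝓝 (ρ f))
  indicator_lt_top : ∀ (s : Set ℝ) (f : MHalfLine), MeasurableSet s → halfLine s < ∞ →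
    (∀ᵐ t ∂halfLine, f t = s.indicator (fun _ => (1 : ℂ)) t) → ρ f < ∞
  space_quasiNorm : IsQuasiNorm (riNorm μ ρ)
  space_complete : IsCompleteFor (riNorm μ ρ)

/-! ### Dilations and Boyd indices -/

theorem quasiMeasurePreserving_dilation {a : ℝ} (ha : 0 < a) :
    Measure.QuasiMeasurePreserving (fun t : ℝ => a * t) halfLine halfLine := by
  refine ⟨measurable_const_mul a, ?_⟩
  refine Measure.AbsolutelyContinuous.mk fun s hs h0 => ?_
  rw [Measure.map_apply (measurable_const_mul a) hs,
    Measure.restrict_apply (measurable_const_mul a hs)]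
  rw [Measure.restrict_apply hs] at h0
  have h : (fun t : ℝ => a * t) ⁻¹' s ∩ Ioi 0 = (fun t : ℝ => a * t) ⁻¹' (s ∩ Ioi 0) := by
    ext t
    simp [ha]
  rw [h, Real.volume_preimage_mul_left ha.ne', h0, mul_zero]

/-- The dilation operator `(D_a f)(t) = f (a t)` on `𝔐(0, ∞)`. -/
def dilation {a : ℝ} (ha : 0 < a) (f : MHalfLine) : MHalfLine :=
  f.compQuasiMeasurePreserving (fun t => a * t) (quasiMeasurePreserving_dilation ha)

/-- The operator norm of `D_a` on the space `{f ∈ 𝔐(0, ∞) | ρ(f^*) < ∞}`. -/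
def dilationNorm (ρ : MHalfLine → ℝ≥0∞) {a : ℝ} (ha : 0 < a) : ℝ≥0∞ :=
  sInf {C : ℝ≥0∞ | ∀ f ∈ riSpace halfLine ρ,
    riNorm halfLine ρ (dilation ha f) ≤ C * riNorm halfLine ρ f}

/-- The lower Boyd index `p_E`. -/
def lowerBoyd (ρ : MHalfLine → ℝ≥0∞) : ℝ≥0∞ :=
  sSup {x : ℝ≥0∞ | ∃ p : ℝ, 0 < p ∧ x = ENNReal.ofReal p ∧ ∃ c : ℝ, 0 < c ∧
    ∀ (a : ℝ) (ha : 0 < a), a < 1 → dilationNorm ρ ha ≤ ENNReal.ofReal (c * a ^ (-(1 / p)))}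

/-- The upper Boyd index `q_E` (equal to `∞` if no exponent is admissible). -/
def upperBoyd (ρ : MHalfLine → ℝ≥0∞) : ℝ≥0∞ :=
  sInf {x : ℝ≥0∞ | ∃ q : ℝ, 0 < q ∧ x = ENNReal.ofReal q ∧ ∃ c : ℝ, 0 < c ∧
    ∀ (a : ℝ) (ha : 0 < a), 1 ≤ a → dilationNorm ρ ha ≤ ENNReal.ofReal (c * a ^ (-(1 / q)))}

/-! ### Lorentz spaces -/

/-- The Lorentz quasi-norm `‖t^{1/p - 1/q} f^*(t)‖_{L_q(0,∞)}` for `q < ∞`, and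
`sup_{t > 0} t^{1/p} f^*(t)` for `q = ∞` (with `1/∞ = 0`). -/
def lorentzNorm {Ω : Type*} [MeasurableSpace Ω] (μ : Measure Ω) (p q : ℝ≥0∞)
    (f : Ω →ₘ[μ] ℂ) : ℝ≥0∞ :=
  if q = ∞ then
    ⨆ (t : ℝ) (_ : 0 < t), ENNReal.ofReal (t ^ (p⁻¹.toReal)) * rearr μ f t
  else
    (∫⁻ t in Ioi (0 : ℝ),
      (ENNReal.ofReal (t ^ (p⁻¹.toReal - q⁻¹.toReal)) * rearr μ f t) ^ q.toReal) ^ (1 / q.toReal)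

/-! ### The K-functional and Ho's interpolation functor

A couple `(X₀, X₁)` of quasi-normed spaces inside a common vector space `V` is given by two extended
quasi-norms `N₀, N₁ : V → [0, ∞]` with `Xᵢ = {v | Nᵢ v < ∞}`. -/

/-- Peetre's K-functional `K(t, x; X₀, X₁)` for `t > 0`. Decompositions with `x₀ ∉ X₀` or `x₁ ∉ X₁`
contribute the value `∞`, so they do not affect the infimum. -/
def kFunctional {V : Type*} [AddCommGroup V] (N₀ N₁ : V → ℝ≥0∞) (t : ℝ) (x : V) : ℝ≥0∞ :=
  ⨅ (x₀ : V) (x₁ : V) (_ : x = x₀ + x₁), N₀ x₀ + ENNReal.ofReal t * N₁ x₁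

/-- The sum `X₀ + X₁`. -/
def sumSpace {V : Type*} [AddCommGroup V] (N₀ N₁ : V → ℝ≥0∞) : Set V :=
  {x | ∃ x₀ x₁ : V, N₀ x₀ < ∞ ∧ N₁ x₁ < ∞ ∧ x = x₀ + x₁}

/-- The quasi-norm `ρ(t^{-1/r} K(t^{1/Θ}, x; X₀, X₁))` of Ho's space `(X₀, X₁)_{Θ, r; E}`. -/
def hoNorm {V : Type*} [AddCommGroup V] (ρ : MHalfLine → ℝ≥0∞) (Θ r : ℝ) (N₀ N₁ : V → ℝ≥0∞)
    (x : V) : ℝ≥0∞ :=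
  evalNonneg ρ
    (fun t => ENNReal.ofReal (t ^ (-(1 / r))) * kFunctional N₀ N₁ (t ^ (1 / Θ)) x)

/-- Ho's space `(X₀, X₁)_{Θ, r; E}`. -/
def hoSpace {V : Type*} [AddCommGroup V] (ρ : MHalfLine → ℝ≥0∞) (Θ r : ℝ) (N₀ N₁ : V → ℝ≥0∞) :
    Set V :=
  {x | x ∈ sumSpace N₀ N₁ ∧ hoNorm ρ Θ r N₀ N₁ x < ∞}

end

/-! ### Calculus of `evalNonneg` -/

/-! The aim is to compare `t^(-1/p₀) K(t^(1/Θ), f)` with `f^*`, up to operators that are bounded on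
non-increasing functions.

Upper estimate: cut `f` at the level `f^*(t)` (`exists_truncation`). The large part has its
rearrangement below `f^*` and zero beyond `t`; the small part has its rearrangement below both `f^*`
and `f^*(t)`. Choose `α` with `1/p < α < 1/p₀`, where `p > p₀` is admissible for the lower Boyd
index. Then `f^*(u) ≤ (u/t)^(-α) U(t)` for `u ≤ t`, where `U` is a weighted sum of dilates of `f^*`.
When `p₁ < ∞`, a similar bound with some `β > 1/p₁` holds for `u ≥ t`. Power profiles of this kind
have Lorentz quasi-norm of order `t^(1/pᵢ) U(t)` whatever the second index (`lorentzNorm_le`), hence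
`t^(-1/p₀) K(t^(1/Θ), f) ≤ C U(t)`. The Boyd bounds make `U` bounded: the dilation ratio is taken so
extreme that the weights beat both the dilation norms and the powers of the quasi-triangle constant
(`exists_majorant_left`, `exists_majorant_right`). The Fatou property then passes to infinite sums
(`eval_tsum_le`).

Lower estimate: each Lorentz space embeds in its weak version (`rearr_le_lorentzNorm`), so `f^*(2s)
≤ f₀^*(s) + f₁^*(s)` is at most a constant times `s^(-1/p₀) K(s^(1/Θ), f)`. Boundedness of the
dilation by `1/2` removes the factor 2. -/

theorem evalNonneg_eq {ρ : MHalfLine → ℝ≥0∞}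
    (hlat : ∀ f g : MHalfLine, (∀ᵐ t ∂halfLine, ‖g t‖ ≤ ‖f t‖) → ρ g ≤ ρ f)
    {g : ℝ → ℝ≥0∞} {F : MHalfLine} (h : ∀ᵐ t ∂halfLine, g t = ‖F t‖ₑ) :
    evalNonneg ρ g = ρ F := by
  refine le_antisymm (iInf₂_le F h) (le_iInf₂ fun G hG => hlat _ _ ?_)
  filter_upwards [h, hG] with t h1 h2
  rw [← enorm_le_iff_norm_le, ← h1, ← h2]

theorem exists_of_evalNonneg_lt_top {ρ : MHalfLine → ℝ≥0∞} {g : ℝ → ℝ≥0∞}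
    (h : evalNonneg ρ g < ∞) : ∃ F : MHalfLine, ∀ᵐ t ∂halfLine, g t = ‖F t‖ₑ := by
  simp only [evalNonneg, iInf_lt_iff] at h
  obtain ⟨F, hF, -⟩ := h
  exact ⟨F, hF⟩

/-- The class of `t ↦ (g t).toReal`. -/
noncomputable def ofENNReal (g : ℝ → ℝ≥0∞) (hg : Measurable g) : MHalfLine :=
  AEEqFun.mk (fun t => ((g t).toReal : ℂ))
    (Complex.measurable_ofReal.comp hg.ennreal_toReal).aestronglyMeasurable

theorem coeFn_ofENNReal (g : ℝ → ℝ≥0∞) (hg : Measurable g) :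
    ∀ᵐ t ∂halfLine, ofENNReal g hg t = ((g t).toReal : ℂ) :=
  AEEqFun.coeFn_mk _ _

theorem enorm_ofENNReal {g : ℝ → ℝ≥0∞} (hg : Measurable g) (hfin : ∀ᵐ t ∂halfLine, g t ≠ ∞) :
    ∀ᵐ t ∂halfLine, g t = ‖ofENNReal g hg t‖ₑ := by
  filter_upwards [coeFn_ofENNReal g hg, hfin] with t h1 h2
  rw [h1, ← ofReal_norm, Complex.norm_real, Real.norm_eq_abs,
    abs_of_nonneg ENNReal.toReal_nonneg, ENNReal.ofReal_toReal h2]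

namespace IsRIQuasiBanach

variable {Ω : Type*} [MeasurableSpace Ω] {μ : Measure Ω} {ρ : MHalfLine → ℝ≥0∞}

theorem eval_ofENNReal (hE : IsRIQuasiBanach μ ρ) {g : ℝ → ℝ≥0∞} (hg : Measurable g)
    (hfin : ∀ᵐ t ∂halfLine, g t ≠ ∞) : evalNonneg ρ g = ρ (ofENNReal g hg) :=
  evalNonneg_eq hE.lattice (enorm_ofENNReal hg hfin)

/-- When `h` has no representative the right side is an infimum over nothing, namely `∞`. Otherwise
`h`, hence `g`, is finite a.e., and measurability of `g` supplies a representative for the lattice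
property. -/
theorem eval_mono (hE : IsRIQuasiBanach μ ρ) {g h : ℝ → ℝ≥0∞} (hg : Measurable g)
    (hgh : ∀ᵐ t ∂halfLine, g t ≤ h t) : evalNonneg ρ g ≤ evalNonneg ρ h := by
  refine le_iInf₂ fun H hH => ?_
  have hfin : ∀ᵐ t ∂halfLine, g t ≠ ∞ := by
    filter_upwards [hgh, hH] with t h1 h2
    exact ne_top_of_le_ne_top (by rw [h2]; exact enorm_ne_top) h1
  rw [hE.eval_ofENNReal hg hfin]
  refine hE.lattice _ _ ?_
  filter_upwards [hgh, hH, enorm_ofENNReal hg hfin] with t h1 h2 h3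
  rw [← enorm_le_iff_norm_le, ← h3, ← h2]
  exact h1

theorem eval_mul_le (hE : IsRIQuasiBanach μ ρ) {g : ℝ → ℝ≥0∞} (c : ℝ≥0)
    (hfin : evalNonneg ρ g < ∞) :
    evalNonneg ρ (fun t => c * g t) = c * evalNonneg ρ g := by
  obtain ⟨G, hG⟩ := exists_of_evalNonneg_lt_top hfin
  rw [evalNonneg_eq hE.lattice hG]
  have hc : ‖((c : ℝ) : ℂ)‖ₑ = c := by
    rw [← ofReal_norm, Complex.norm_real, Real.norm_eq_abs, NNReal.abs_eq,
      ENNReal.ofReal_coe_nnreal]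
  have : ∀ᵐ t ∂halfLine, c * g t = ‖(((c : ℝ) : ℂ) • G) t‖ₑ := by
    filter_upwards [hG, AEEqFun.coeFn_smul ((c : ℝ) : ℂ) G] with t h1 h2
    rw [h1, h2, Pi.smul_apply, enorm_smul, hc]
  rw [evalNonneg_eq hE.lattice this, hE.quasiNorm.smul, hc]

theorem exists_eval_add_le (hE : IsRIQuasiBanach μ ρ) :
    ∃ K : ℝ≥0, 1 ≤ K ∧ ∀ g h : ℝ → ℝ≥0∞, Measurable g → Measurable h →
      evalNonneg ρ (fun t => g t + h t) ≤ K * (evalNonneg ρ g + evalNonneg ρ h) := by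
  obtain ⟨C, hC⟩ := hE.quasiNorm.add_le
  have hK : (max C 1 : ℝ≥0) ≠ 0 := (lt_of_lt_of_le one_pos (le_max_right C 1)).ne'
  refine ⟨max C 1, le_max_right _ _, fun g h hg hh => ?_⟩
  rcases eq_or_ne (evalNonneg ρ g) ∞ with h1 | h1
  · rw [h1, top_add, ENNReal.mul_top (by exact_mod_cast hK)]
    exact le_top
  rcases eq_or_ne (evalNonneg ρ h) ∞ with h2 | h2
  · rw [h2, add_top, ENNReal.mul_top (by exact_mod_cast hK)]
    exact le_top
  obtain ⟨G, hG⟩ := exists_of_evalNonneg_lt_top h1.lt_top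
  obtain ⟨H, hH⟩ := exists_of_evalNonneg_lt_top h2.lt_top
  have hg' : ∀ᵐ t ∂halfLine, g t ≠ ∞ := by
    filter_upwards [hG] with t ht
    rw [ht]; exact enorm_ne_top
  have hh' : ∀ᵐ t ∂halfLine, h t ≠ ∞ := by
    filter_upwards [hH] with t ht
    rw [ht]; exact enorm_ne_top
  -- Arbitrary representatives `G`, `H` may cancel in `G + H`; the non-negative ones satisfy `|G +
  -- H| = g + h`.
  rw [hE.eval_ofENNReal hg hg', hE.eval_ofENNReal hh hh']
  have : ∀ᵐ t ∂halfLine, g t + h t = ‖(ofENNReal g hg + ofENNReal h hh) t‖ₑ := by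
    filter_upwards [hg', hh', coeFn_ofENNReal g hg, coeFn_ofENNReal h hh,
      AEEqFun.coeFn_add (ofENNReal g hg) (ofENNReal h hh)] with t a1 a2 a3 a4 a5
    rw [a5, Pi.add_apply, a3, a4, ← Complex.ofReal_add, ← ENNReal.toReal_add a1 a2,
      ← ofReal_norm, Complex.norm_real, Real.norm_eq_abs,
      abs_of_nonneg ENNReal.toReal_nonneg, ENNReal.ofReal_toReal (ENNReal.add_ne_top.2 ⟨a1, a2⟩)]
  rw [evalNonneg_eq hE.lattice this]
  refine (hC _ _).trans ?_
  gcongr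
  exact le_max_left _ _

/-- The Fatou property for a limit known to be finite almost everywhere. -/
theorem eval_le_of_tendsto (hE : IsRIQuasiBanach μ ρ) {h : ℕ → ℝ → ℝ≥0∞} {S : ℝ → ℝ≥0∞}
    (hm : ∀ n, Measurable (h n)) (hS : Measurable S) (hmono : ∀ t, Monotone fun n => h n t)
    (hlim : ∀ t, Tendsto (fun n => h n t) atTop (𝓝 (S t)))
    (hfin : ∀ᵐ t ∂halfLine, S t ≠ ∞) {M : ℝ≥0∞}
    (hM : ∀ n, evalNonneg ρ (h n) ≤ M) : evalNonneg ρ S ≤ M := by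
  have hle : ∀ n t, h n t ≤ S t := fun n t => (hmono t).ge_of_tendsto (hlim t) n
  have hfin' : ∀ n, ∀ᵐ t ∂halfLine, h n t ≠ ∞ := fun n => by
    filter_upwards [hfin] with t ht
    exact ne_top_of_le_ne_top ht (hle n t)
  have key := (hE.fatou (fun n => ofENNReal (h n) (hm n)) (ofENNReal S hS) (by
    filter_upwards [hfin, ae_all_iff.2 fun n => coeFn_ofENNReal (h n) (hm n),
      coeFn_ofENNReal S hS] with t h1 h2 h3
    simp only [h2, h3]
    refine ⟨fun n => by exact_mod_cast ENNReal.toReal_nonneg, fun n m hnm => ?_, ?_⟩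
    · have := ENNReal.toReal_mono (ne_top_of_le_ne_top h1 (hle m t)) (hmono t hnm)
      exact Complex.real_le_real.2 this
    · exact (Complex.continuous_ofReal.tendsto _).comp
        ((ENNReal.tendsto_toReal h1).comp (hlim t)))).2
  rw [hE.eval_ofENNReal hS hfin]
  refine le_of_tendsto' key fun n => ?_
  rw [← hE.eval_ofENNReal (hm n) (hfin' n)]
  exact hM n

/-- The Fatou axiom presupposes a limit in `𝔐(0, ∞)`, so finiteness of the limit has to come from
the norm bound. If `χ` is the indicator of `{S = ∞}`, then `j χ` has quasi-norm at most `M` for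
every `j`, so `χ` has quasi-norm zero and vanishes a.e. -/
theorem ae_ne_top_of_eval_le (hE : IsRIQuasiBanach μ ρ) {h : ℕ → ℝ → ℝ≥0∞} {S : ℝ → ℝ≥0∞}
    (hm : ∀ n, Measurable (h n)) (hS : Measurable S) (hmono : ∀ t, Monotone fun n => h n t)
    (hlim : ∀ t, Tendsto (fun n => h n t) atTop (𝓝 (S t))) {M : ℝ≥0∞} (hMtop : M ≠ ∞)
    (hM : ∀ n, evalNonneg ρ (h n) ≤ M) : ∀ᵐ t ∂halfLine, S t ≠ ∞ := by
  set A : Set ℝ := S ⁻¹' {∞} with hA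
  have hAm : MeasurableSet A := hS (measurableSet_singleton _)
  set χ : ℝ → ℝ≥0∞ := A.indicator fun _ => 1 with hχ
  have hχm : Measurable χ := measurable_const.indicator hAm
  have hχfin : ∀ t, χ t ≠ ∞ := fun t => by
    by_cases ht : t ∈ A <;> simp [hχ, ht]
  have hbound : ∀ j : ℕ, evalNonneg ρ (fun t => (j : ℝ≥0) * χ t) ≤ M := fun j => by
    -- The truncations `min (h n) (j χ)` increase to the finite function `j χ`, so the finite-limit
    -- form of Fatou applies.
    refine hE.eval_le_of_tendsto (h := fun n t => min (h n t) (j * χ t))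
      (fun n => (hm n).min (hχm.const_mul _)) (hχm.const_mul _)
      (fun t n m hnm => min_le_min_right _ (hmono t hnm)) (fun t => ?_) (ae_of_all _ fun t => ?_)
      (fun n => ?_)
    · by_cases ht : t ∈ A
      · have h1 := (hlim t).min (tendsto_const_nhds (x := (j * χ t : ℝ≥0∞)))
        have h2 : S t = ∞ := ht
        rw [h2, min_eq_right le_top] at h1
        simpa using h1
      · simp [hχ, ht]
    · exact ENNReal.mul_ne_top ENNReal.coe_ne_top (hχfin t)
    · exact (hE.eval_mono ((hm n).min (hχm.const_mul _))
        (ae_of_all _ fun t => min_le_left _ _)).trans (hM n)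
  have h1 : evalNonneg ρ χ < ∞ := by
    have := hbound 1
    simp only [Nat.cast_one, ENNReal.coe_one, one_mul] at this
    exact this.trans_lt hMtop.lt_top
  have h0 : evalNonneg ρ χ = 0 := by
    by_contra hne
    obtain ⟨j, hj⟩ := ENNReal.exists_nat_mul_gt hne hMtop
    have := hbound j
    rw [hE.eval_mul_le _ h1] at this
    exact absurd hj (not_lt.2 (by simpa using this))
  rw [hE.eval_ofENNReal hχm (ae_of_all _ hχfin), hE.quasiNorm.eq_zero_iff] at h0
  have hz := enorm_ofENNReal hχm (ae_of_all _ hχfin)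
  rw [h0] at hz
  filter_upwards [hz, AEEqFun.coeFn_zero (α := ℝ) (β := ℂ) (μ := halfLine)] with t ht ht0 hSt
  have hmem : t ∈ A := hSt
  rw [ht0] at ht
  simp [hχ, hmem] at ht

/-- Peeling off the first summand costs one factor `K`, and the tail is treated recursively. The
cost of a term thus depends on its position and not on the number of terms, which is what allows
passage to series. -/
theorem eval_sum_le (hE : IsRIQuasiBanach μ ρ) {K : ℝ≥0}
    (hK : ∀ g h : ℝ → ℝ≥0∞, Measurable g → Measurable h →
      evalNonneg ρ (fun t => g t + h t) ≤ K * (evalNonneg ρ g + evalNonneg ρ h)) (n : ℕ) :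
    ∀ (h : ℕ → ℝ → ℝ≥0∞), (∀ k, Measurable (h k)) →
      evalNonneg ρ (fun t => ∑ k ∈ Finset.range n, h k t) ≤
        ∑ k ∈ Finset.range n, (K : ℝ≥0∞) ^ (k + 1) * evalNonneg ρ (h k) := by
  induction n with
  | zero =>
    intro h _
    simp only [Finset.range_zero, Finset.sum_empty]
    have : ∀ᵐ t ∂halfLine, (0 : ℝ≥0∞) = ‖(0 : MHalfLine) t‖ₑ := by
      filter_upwards [AEEqFun.coeFn_zero (α := ℝ) (β := ℂ) (μ := halfLine)] with t ht
      simp [ht]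
    rw [evalNonneg_eq hE.lattice this, (hE.quasiNorm.eq_zero_iff 0).2 rfl]
  | succ n ih =>
    intro h hm
    simp only [Finset.sum_range_succ']
    refine (hK _ _ (Finset.measurable_fun_sum _ fun k _ => hm (k + 1)) (hm 0)).trans ?_
    rw [mul_add, zero_add, pow_one]
    gcongr
    refine (mul_le_mul_right (ih (fun k => h (k + 1)) fun k => hm (k + 1)) _).trans ?_
    rw [Finset.mul_sum]
    refine Finset.sum_le_sum fun k _ => ?_
    rw [← mul_assoc, ← pow_succ']

theorem eval_tsum_le (hE : IsRIQuasiBanach μ ρ) {K : ℝ≥0}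
    (hK : ∀ g h : ℝ → ℝ≥0∞, Measurable g → Measurable h →
      evalNonneg ρ (fun t => g t + h t) ≤ K * (evalNonneg ρ g + evalNonneg ρ h))
    {h : ℕ → ℝ → ℝ≥0∞} (hm : ∀ k, Measurable (h k))
    (hfin : ∑' k, (K : ℝ≥0∞) ^ (k + 1) * evalNonneg ρ (h k) ≠ ∞) :
    evalNonneg ρ (fun t => ∑' k, h k t) ≤ ∑' k, (K : ℝ≥0∞) ^ (k + 1) * evalNonneg ρ (h k) := by
  have h1 : ∀ n, Measurable fun t => ∑ k ∈ Finset.range n, h k t :=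
    fun n => Finset.measurable_fun_sum _ fun k _ => hm k
  have h2 : Measurable fun t => ∑' k, h k t := Measurable.tsum hm
  have h3 : ∀ t, Monotone fun n => ∑ k ∈ Finset.range n, h k t := fun t n m hnm =>
    Finset.sum_le_sum_of_subset (Finset.range_mono hnm)
  have h4 : ∀ t, Tendsto (fun n => ∑ k ∈ Finset.range n, h k t) atTop (𝓝 (∑' k, h k t)) :=
    fun t => ENNReal.summable.hasSum.tendsto_sum_nat
  have h5 : ∀ n, evalNonneg ρ (fun t => ∑ k ∈ Finset.range n, h k t) ≤
      ∑' k, (K : ℝ≥0∞) ^ (k + 1) * evalNonneg ρ (h k) := fun n =>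
    (hE.eval_sum_le hK n h hm).trans (ENNReal.sum_le_tsum _)
  exact hE.eval_le_of_tendsto h1 h2 h3 h4 (hE.ae_ne_top_of_eval_le h1 h2 h3 h4 hfin h5) h5

end IsRIQuasiBanach

/-! ### Rearrangements -/

theorem rearr_antitone {Ω : Type*} [MeasurableSpace Ω] (μ : Measure Ω) (f : Ω →ₘ[μ] ℂ) :
    Antitone (rearr μ f) := fun _ _ hst =>
  sInf_le_sInf fun _ hx => le_trans hx (ENNReal.ofReal_le_ofReal hst)

/-- Up to a null set, `|G|` can exceed `g t` only to the left of `t`. With the converse below, a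
non-increasing function is a.e. its own rearrangement; this transfers `dilationNorm`, defined
through `ρ(f^*)`, to `evalNonneg`. -/
theorem rearr_le_of_antitone {g : ℝ → ℝ≥0∞} (hg : Antitone g) {G : MHalfLine}
    (hG : ∀ᵐ t ∂halfLine, g t = ‖G t‖ₑ) (t : ℝ) : rearr halfLine G t ≤ g t := by
  refine sInf_le ?_
  have h : ({x | g t < ‖G x‖ₑ} : Set ℝ) ≤ᵐ[halfLine] Iio t := by
    filter_upwards [hG] with x hx (hx' : g t < ‖G x‖ₑ)
    rw [← hx] at hx'
    exact not_le.1 fun hle => absurd hx' (not_lt.2 (hg hle))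
  refine (measure_mono_ae h).trans ?_
  rw [Measure.restrict_apply measurableSet_Iio, inter_comm, Ioi_inter_Iio, Real.volume_Ioo,
    sub_zero]

/-- At a continuity point `g t` is the limit of `g u` as `u ↓ t`, and a monotone function has only
countably many discontinuities. -/
theorem le_rearr_of_antitone {g : ℝ → ℝ≥0∞} (hg : Antitone g) {G : MHalfLine}
    (hG : ∀ᵐ t ∂halfLine, g t = ‖G t‖ₑ) : ∀ᵐ t ∂halfLine, g t ≤ rearr halfLine G t := by
  have hc : ∀ᵐ t ∂halfLine, ContinuousAt g t :=
    ae_restrict_of_ae (hg.countable_not_continuousAt.ae_notMem volume |>.mono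
      fun t ht => not_not.1 ht)
  filter_upwards [hc, ae_restrict_mem measurableSet_Ioi] with t ht (ht0 : 0 < t)
  -- A level `s < g u` is exceeded on `(0, u]`, whose measure is larger than `t`, so `s` is not
  -- admissible in the infimum.
  have hlt : ∀ u, t < u → g u ≤ rearr halfLine G t := by
    refine fun u hu => le_sInf fun s (hs : halfLine {x | s < ‖G x‖ₑ} ≤ ENNReal.ofReal t) => ?_
    by_contra! hsu
    have h : (Iic u : Set ℝ) ≤ᵐ[halfLine] {x | s < ‖G x‖ₑ} := by
      filter_upwards [hG] with x hx (hx' : x ≤ u)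
      change s < ‖G x‖ₑ
      rw [← hx]
      exact hsu.trans_le (hg hx')
    have h' := (measure_mono_ae h).trans hs
    rw [Measure.restrict_apply measurableSet_Iic, inter_comm, Ioi_inter_Iic, Real.volume_Ioc,
      sub_zero, ENNReal.ofReal_le_ofReal_iff ht0.le] at h'
    exact absurd hu (not_lt.2 h')
  have h1 : Tendsto g (𝓝[>] t) (𝓝 (g t)) := ht.tendsto.mono_left nhdsWithin_le_nhds
  exact le_of_tendsto h1 (eventually_mem_nhdsWithin.mono hlt)

theorem IsRIQuasiBanach.eval_dilation_le {Ω : Type*} [MeasurableSpace Ω] {μ : Measure Ω}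
    {ρ : MHalfLine → ℝ≥0∞} (hE : IsRIQuasiBanach μ ρ) {g : ℝ → ℝ≥0∞} (hg : Antitone g)
    (hfin : evalNonneg ρ g < ∞) {a : ℝ} (ha : 0 < a) {C : ℝ≥0∞} (hC : dilationNorm ρ ha < C) :
    evalNonneg ρ (fun t => g (a * t)) ≤ C * evalNonneg ρ g := by
  obtain ⟨G, hG⟩ := exists_of_evalNonneg_lt_top hfin
  have h1 : riNorm halfLine ρ G ≤ evalNonneg ρ g :=
    hE.eval_mono (rearr_antitone _ _).measurable (ae_of_all _ (rearr_le_of_antitone hg hG))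
  obtain ⟨C', hC', hlt⟩ := sInf_lt_iff.1 hC
  have hga : Antitone fun t => g (a * t) := fun x y hxy =>
    hg (mul_le_mul_of_nonneg_left hxy ha.le)
  have hD : ∀ᵐ t ∂halfLine, g (a * t) = ‖dilation ha G t‖ₑ := by
    filter_upwards [AEEqFun.coeFn_compQuasiMeasurePreserving G
      (quasiMeasurePreserving_dilation ha), (quasiMeasurePreserving_dilation ha).ae hG]
      with t h2 h3
    rw [h3, dilation, h2, Function.comp_apply]
  calc evalNonneg ρ (fun t => g (a * t)) ≤ riNorm halfLine ρ (dilation ha G) :=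
        hE.eval_mono hga.measurable (le_rearr_of_antitone hga hD)
    _ ≤ C' * riNorm halfLine ρ G := hC' G (h1.trans_lt hfin)
    _ ≤ C * evalNonneg ρ g := mul_le_mul' hlt.le h1

/-! ### Maximal functions of Hardy type -/

namespace IsRIQuasiBanach

variable {Ω : Type*} [MeasurableSpace Ω] {μ : Measure Ω} {ρ : MHalfLine → ℝ≥0∞}

/-- A weighted sum of dilations is bounded on non-increasing functions, if the weights beat the
norms of the dilations and the constant of the quasi-triangle inequality geometrically. -/
theorem eval_tsum_dilation_le (hE : IsRIQuasiBanach μ ρ) {K : ℝ≥0}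
    (hK : ∀ g h : ℝ → ℝ≥0∞, Measurable g → Measurable h →
      evalNonneg ρ (fun t => g t + h t) ≤ K * (evalNonneg ρ g + evalNonneg ρ h))
    {a w d : ℕ → ℝ} (ha : ∀ k, 0 < a k) (hw : ∀ k, 0 ≤ w k) (hd : ∀ k, 0 < d k)
    (had : ∀ k, dilationNorm ρ (ha k) ≤ ENNReal.ofReal (d k)) {A : ℝ} (hA : 0 ≤ A)
    (hsum : ∀ k, (K : ℝ) ^ (k + 1) * (w k * (2 * d k)) ≤ A * (1 / 2) ^ k)
    {g : ℝ → ℝ≥0∞} (hg : Antitone g) (hfin : evalNonneg ρ g < ∞) :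
    evalNonneg ρ (fun t => ∑' k, ENNReal.ofReal (w k) * g (a k * t)) ≤
      ENNReal.ofReal (A * 2) * evalNonneg ρ g := by
  have hga : ∀ k, Antitone fun t => g (a k * t) := fun k x y hxy =>
    hg (mul_le_mul_of_nonneg_left hxy (ha k).le)
  have hterm : ∀ k, (K : ℝ≥0∞) ^ (k + 1) *
      evalNonneg ρ (fun t => ENNReal.ofReal (w k) * g (a k * t)) ≤
      ENNReal.ofReal (A * (1 / 2) ^ k) * evalNonneg ρ g := fun k => by
    -- The factor 2 gives a strict inequality: the operator norm is an infimum, not known to be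
    -- attained.
    have hlt : dilationNorm ρ (ha k) < ENNReal.ofReal (2 * d k) :=
      (had k).trans_lt ((ENNReal.ofReal_lt_ofReal_iff (by linarith [hd k])).2
        (by linarith [hd k]))
    have h1 := hE.eval_dilation_le hg hfin (ha k) hlt
    have h2 : evalNonneg ρ (fun t => g (a k * t)) < ∞ :=
      h1.trans_lt (ENNReal.mul_lt_top ENNReal.ofReal_lt_top hfin)
    have h3 := hE.eval_mul_le (Real.toNNReal (w k)) h2
    change evalNonneg ρ (fun t => ENNReal.ofReal (w k) * g (a k * t)) = ENNReal.ofReal (w k) * _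
      at h3
    rw [h3]
    calc (K : ℝ≥0∞) ^ (k + 1) * (ENNReal.ofReal (w k) * evalNonneg ρ fun t => g (a k * t))
        ≤ (K : ℝ≥0∞) ^ (k + 1) *
          (ENNReal.ofReal (w k) * (ENNReal.ofReal (2 * d k) * evalNonneg ρ g)) := by gcongr
      _ = ENNReal.ofReal ((K : ℝ) ^ (k + 1) * (w k * (2 * d k))) * evalNonneg ρ g := by
          rw [ENNReal.ofReal_mul (p := (K : ℝ) ^ (k + 1)) (by positivity), ENNReal.ofReal_mul (hw k),
            ENNReal.ofReal_pow (by positivity), ENNReal.ofReal_coe_nnreal]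
          ring
      _ ≤ _ := mul_le_mul_left (ENNReal.ofReal_le_ofReal (hsum k)) _
  have hs : ∑' k, ENNReal.ofReal (A * (1 / 2) ^ k) * evalNonneg ρ g =
      ENNReal.ofReal (A * 2) * evalNonneg ρ g := by
    have hS := hasSum_geometric_two.mul_left A
    rw [ENNReal.tsum_mul_right, ← ENNReal.ofReal_tsum_of_nonneg (fun k => by positivity)
      hS.summable, hS.tsum_eq]
  have hle := ENNReal.tsum_le_tsum hterm
  rw [hs] at hle
  refine (hE.eval_tsum_le hK (fun k => (hga k).measurable.const_mul _) ?_).trans hle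
  exact ne_top_of_le_ne_top (ENNReal.mul_lt_top ENNReal.ofReal_lt_top hfin).ne hle

/-- Boundedness of `g ↦ sup_{0 < v ≤ 1} v ^ α g (v t)`, for `α` above the growth exponent of the
dilations with small parameter. -/
theorem exists_majorant_left (hE : IsRIQuasiBanach μ ρ) {c p α : ℝ} (hc : 0 < c)
    (hα0 : 0 ≤ α) (hα : 1 / p < α)
    (hD : ∀ (a : ℝ) (ha : 0 < a), a < 1 →
      dilationNorm ρ ha ≤ ENNReal.ofReal (c * a ^ (-(1 / p)))) :
    ∃ M : ℝ≥0, ∀ g : ℝ → ℝ≥0∞, Antitone g → evalNonneg ρ g < ∞ →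
      ∃ U : ℝ → ℝ≥0∞, Measurable U ∧ evalNonneg ρ U ≤ M * evalNonneg ρ g ∧
        ∀ t u : ℝ, 0 < u → u ≤ t → g u ≤ ENNReal.ofReal ((u / t) ^ (-α)) * U t := by
  obtain ⟨K, hK1, hK⟩ := hE.exists_eval_add_le
  have hK0 : (0 : ℝ) < K := lt_of_lt_of_le one_pos hK1
  have hK1' : (1 : ℝ) ≤ K := hK1
  set ε := α - 1 / p with hε
  have hε0 : 0 < ε := by linarith
  -- Chosen so that `K y^ε = 1/2`: the `k`-th term of the series then decays like `2^(-k)` in spite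
  -- of the factor `K^(k+1)`.
  set y : ℝ := (1 / (2 * K)) ^ (1 / ε) with hy
  have hy0 : 0 < y := by positivity
  have hy1 : y < 1 := Real.rpow_lt_one (by positivity)
    (by rw [div_lt_one (by positivity)]; linarith) (by positivity)
  have hyε : y ^ ε = 1 / (2 * K) := by
    rw [hy, ← Real.rpow_mul (by positivity), one_div_mul_cancel hε0.ne', Real.rpow_one]
  have hsum : ∀ k : ℕ, (K : ℝ) ^ (k + 1) *
      ((y ^ k) ^ α * (2 * (c * (y ^ (k + 1)) ^ (-(1 / p))))) ≤
      (2 * c * K * y ^ (-(1 / p))) * (1 / 2) ^ k := fun k => by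
    have e1 : (y ^ k) ^ α = (y ^ ε) ^ k * (y ^ (1 / p)) ^ k := by
      rw [← mul_pow, ← Real.rpow_add hy0, hε, sub_add_cancel, Real.rpow_pow_comm hy0.le]
    have e2 : (y ^ (k + 1)) ^ (-(1 / p)) = y ^ (-(1 / p)) * (y ^ (-(1 / p))) ^ k := by
      rw [← Real.rpow_pow_comm hy0.le, pow_succ']
    have e3 : (y ^ (1 / p)) ^ k * (y ^ (-(1 / p))) ^ k = 1 := by
      rw [← mul_pow, ← Real.rpow_add hy0, add_neg_cancel, Real.rpow_zero, one_pow]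
    have e4 : (K : ℝ) ^ k * (1 / (2 * K)) ^ k = (1 / 2) ^ k := by
      rw [← mul_pow]; congr 1; field_simp
    rw [e1, e2, hyε]
    refine le_of_eq ?_
    calc (K : ℝ) ^ (k + 1) * ((1 / (2 * K)) ^ k * (y ^ (1 / p)) ^ k *
          (2 * (c * (y ^ (-(1 / p)) * (y ^ (-(1 / p))) ^ k))))
        = (2 * c * K * y ^ (-(1 / p))) * ((K : ℝ) ^ k * (1 / (2 * K)) ^ k) *
          ((y ^ (1 / p)) ^ k * (y ^ (-(1 / p))) ^ k) := by ring
      _ = _ := by rw [e3, e4, mul_one]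
  refine ⟨Real.toNNReal (2 * c * K * y ^ (-(1 / p)) * 2), fun g hg hfin =>
    ⟨fun t => ∑' k : ℕ, ENNReal.ofReal ((y ^ k) ^ α) * g (y ^ (k + 1) * t), ?_, ?_, ?_⟩⟩
  · exact Measurable.tsum fun k =>
      ((hg.measurable.comp (measurable_const_mul (y ^ (k + 1)))).const_mul _)
  · exact hE.eval_tsum_dilation_le hK (a := fun k => y ^ (k + 1)) (w := fun k => (y ^ k) ^ α)
      (d := fun k => c * (y ^ (k + 1)) ^ (-(1 / p))) (fun k => by positivity)
      (fun k => by positivity) (fun k => by positivity)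
      (fun k => hD _ _ (pow_lt_one₀ hy0.le hy1 (Nat.succ_ne_zero k))) (by positivity) hsum hg hfin
  · intro t u hu hut
    have ht : 0 < t := hu.trans_le hut
    -- With `y^(k+1) < u/t ≤ y^k`, the single term of index `k` already dominates: monotonicity
    -- handles `g`, and the weight `y^(kα)` absorbs `(u/t)^α`.
    obtain ⟨k, hk1, hk2⟩ := exists_nat_pow_near_of_lt_one (div_pos hu ht)
      ((div_le_one ht).2 hut) hy0 hy1
    have hv : 0 < u / t := div_pos hu ht
    have h1 : g u ≤ g (y ^ (k + 1) * t) := hg ((lt_div_iff₀ ht).1 hk1).le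
    have h2 : 1 ≤ (u / t) ^ (-α) * (y ^ k) ^ α := by
      rw [Real.rpow_neg hv.le, ← div_eq_inv_mul, one_le_div (by positivity)]
      exact Real.rpow_le_rpow hv.le hk2 hα0
    calc g u = 1 * g u := (one_mul _).symm
      _ ≤ ENNReal.ofReal ((u / t) ^ (-α) * (y ^ k) ^ α) * g (y ^ (k + 1) * t) := by
          gcongr
          exact ENNReal.one_le_ofReal.2 h2
      _ = ENNReal.ofReal ((u / t) ^ (-α)) * (ENNReal.ofReal ((y ^ k) ^ α) *
          g (y ^ (k + 1) * t)) := by rw [ENNReal.ofReal_mul (by positivity), mul_assoc]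
      _ ≤ _ := by
          gcongr
          exact ENNReal.le_tsum (f := fun k : ℕ =>
            ENNReal.ofReal ((y ^ k) ^ α) * g (y ^ (k + 1) * t)) k

/-- Boundedness of `g ↦ sup_{v ≥ 1} v ^ β g (v t)`, for `β` below the decay exponent of the
dilations with large parameter. -/
theorem exists_majorant_right (hE : IsRIQuasiBanach μ ρ) {c q β : ℝ} (hc : 0 < c)
    (hβ0 : 0 ≤ β) (hβ : β < 1 / q)
    (hD : ∀ (a : ℝ) (ha : 0 < a), 1 ≤ a →
      dilationNorm ρ ha ≤ ENNReal.ofReal (c * a ^ (-(1 / q)))) :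
    ∃ M : ℝ≥0, ∀ g : ℝ → ℝ≥0∞, Antitone g → evalNonneg ρ g < ∞ →
      ∃ U : ℝ → ℝ≥0∞, Measurable U ∧ evalNonneg ρ U ≤ M * evalNonneg ρ g ∧
        ∀ t u : ℝ, 0 < t → t ≤ u → g u ≤ ENNReal.ofReal ((u / t) ^ (-β)) * U t := by
  obtain ⟨K, hK1, hK⟩ := hE.exists_eval_add_le
  have hK0 : (0 : ℝ) < K := lt_of_lt_of_le one_pos hK1
  have hK1' : (1 : ℝ) ≤ K := hK1
  set ε := 1 / q - β with hε
  have hε0 : 0 < ε := by linarith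
  -- The counterpart for expanding dilations: `K b^(-ε) = 1/2`.
  set b : ℝ := (2 * K) ^ (1 / ε) with hb
  have hb0 : 0 < b := by positivity
  have hb1 : 1 < b := Real.one_lt_rpow (by linarith) (by positivity)
  have hbε : b ^ (-ε) = 1 / (2 * K) := by
    rw [hb, ← Real.rpow_mul (by positivity), mul_neg, one_div_mul_cancel hε0.ne',
      Real.rpow_neg_one, one_div]
  have hsum : ∀ k : ℕ, (K : ℝ) ^ (k + 1) *
      ((b ^ (k + 1)) ^ β * (2 * (c * (b ^ k) ^ (-(1 / q))))) ≤
      (2 * c * K * b ^ β) * (1 / 2) ^ k := fun k => by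
    have e1 : (b ^ k) ^ (-(1 / q)) = (b ^ (-ε)) ^ k * (b ^ (-β)) ^ k := by
      rw [← mul_pow, ← Real.rpow_add hb0, hε, Real.rpow_pow_comm hb0.le]; congr 2; ring
    have e2 : (b ^ (k + 1)) ^ β = b ^ β * (b ^ β) ^ k := by
      rw [← Real.rpow_pow_comm hb0.le, pow_succ']
    have e3 : (b ^ β) ^ k * (b ^ (-β)) ^ k = 1 := by
      rw [← mul_pow, ← Real.rpow_add hb0, add_neg_cancel, Real.rpow_zero, one_pow]
    have e4 : (K : ℝ) ^ k * (1 / (2 * K)) ^ k = (1 / 2) ^ k := by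
      rw [← mul_pow]; congr 1; field_simp
    rw [e1, e2, hbε]
    refine le_of_eq ?_
    calc (K : ℝ) ^ (k + 1) * (b ^ β * (b ^ β) ^ k *
          (2 * (c * ((1 / (2 * K)) ^ k * (b ^ (-β)) ^ k))))
        = (2 * c * K * b ^ β) * ((K : ℝ) ^ k * (1 / (2 * K)) ^ k) *
          ((b ^ β) ^ k * (b ^ (-β)) ^ k) := by ring
      _ = _ := by rw [e3, e4, mul_one]
  refine ⟨Real.toNNReal (2 * c * K * b ^ β * 2), fun g hg hfin =>
    ⟨fun t => ∑' k : ℕ, ENNReal.ofReal ((b ^ (k + 1)) ^ β) * g (b ^ k * t), ?_, ?_, ?_⟩⟩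
  · exact Measurable.tsum fun k =>
      ((hg.measurable.comp (measurable_const_mul (b ^ k))).const_mul _)
  · exact hE.eval_tsum_dilation_le hK (a := fun k => b ^ k) (w := fun k => (b ^ (k + 1)) ^ β)
      (d := fun k => c * (b ^ k) ^ (-(1 / q))) (fun k => by positivity)
      (fun k => by positivity) (fun k => by positivity)
      (fun k => hD _ _ (one_le_pow₀ hb1.le)) (by positivity) hsum hg hfin
  · intro t u ht htu
    obtain ⟨k, hk1, hk2⟩ := exists_nat_pow_near ((one_le_div ht).2 htu) hb1
    have hv : 0 < u / t := div_pos (ht.trans_le htu) ht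
    have h1 : g u ≤ g (b ^ k * t) := hg ((le_div_iff₀ ht).1 hk1)
    have h2 : 1 ≤ (u / t) ^ (-β) * (b ^ (k + 1)) ^ β := by
      rw [Real.rpow_neg hv.le, ← div_eq_inv_mul, one_le_div (by positivity)]
      exact Real.rpow_le_rpow hv.le hk2.le hβ0
    calc g u = 1 * g u := (one_mul _).symm
      _ ≤ ENNReal.ofReal ((u / t) ^ (-β) * (b ^ (k + 1)) ^ β) * g (b ^ k * t) := by
          gcongr
          exact ENNReal.one_le_ofReal.2 h2
      _ = ENNReal.ofReal ((u / t) ^ (-β)) * (ENNReal.ofReal ((b ^ (k + 1)) ^ β) *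
          g (b ^ k * t)) := by rw [ENNReal.ofReal_mul (by positivity), mul_assoc]
      _ ≤ _ := by
          gcongr
          exact ENNReal.le_tsum (f := fun k : ℕ =>
            ENNReal.ofReal ((b ^ (k + 1)) ^ β) * g (b ^ k * t)) k

end IsRIQuasiBanach

/-! ### Rearrangements of truncations and sums -/

section Rearrangement

variable {Ω : Type*} [MeasurableSpace Ω] {μ : Measure Ω}

/-- The infimum defining `f^*(t)` is attained, by continuity of `μ` from below along levels
decreasing strictly to it. -/
theorem measure_rearr_lt_le (f : Ω →ₘ[μ] ℂ) (t : ℝ) :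
    μ {x | rearr μ f t < ‖f x‖ₑ} ≤ ENNReal.ofReal t := by
  set l := rearr μ f t with hl
  rcases eq_or_ne l ∞ with h | h
  · simp [h]
  obtain ⟨u, hu, hlu, hlim⟩ := exists_seq_strictAnti_tendsto' h.lt_top
  have hset : {x | l < ‖f x‖ₑ} = ⋃ n, {x | u n < ‖f x‖ₑ} := by
    ext x
    simp only [mem_ofPred_eq, mem_iUnion]
    exact ⟨fun hx => (hlim.eventually_lt_const hx).exists, fun ⟨n, hn⟩ => (hlu n).1.trans hn⟩
  have hmono : Monotone fun n => {x | u n < ‖f x‖ₑ} := fun n m hnm x hx =>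
    lt_of_le_of_lt (hu.antitone hnm) hx
  rw [hset, hmono.measure_iUnion]
  refine iSup_le fun n => ?_
  obtain ⟨s, hs, hsn⟩ := sInf_lt_iff.1 (show sInf _ < u n from (hlu n).1)
  exact (measure_mono fun x hx => hsn.trans hx).trans hs

theorem rearr_mono {f g : Ω →ₘ[μ] ℂ} (h : ∀ᵐ x ∂μ, ‖f x‖ₑ ≤ ‖g x‖ₑ) (t : ℝ) :
    rearr μ f t ≤ rearr μ g t :=
  sInf_le_sInf fun s hs => (measure_mono_ae (by
    filter_upwards [h] with x hx (hs' : s < ‖f x‖ₑ)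
    exact hs'.trans_le hx)).trans hs

theorem rearr_le_of_ae_le {f : Ω →ₘ[μ] ℂ} {s : ℝ≥0∞} (h : ∀ᵐ x ∂μ, ‖f x‖ₑ ≤ s) (t : ℝ) :
    rearr μ f t ≤ s := by
  refine sInf_le ?_
  have : μ {x | s < ‖f x‖ₑ} = 0 := measure_mono_null (fun x hx => not_le.2 hx) (ae_iff.1 h)
  simp [this]

theorem rearr_add_le (f g : Ω →ₘ[μ] ℂ) {t : ℝ} (ht : 0 ≤ t) :
    rearr μ (f + g) (2 * t) ≤ rearr μ f t + rearr μ g t := by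
  refine sInf_le ?_
  have hsub : ({x | rearr μ f t + rearr μ g t < ‖(f + g) x‖ₑ} : Set Ω) ≤ᵐ[μ]
      ({x | rearr μ f t < ‖f x‖ₑ} ∪ {x | rearr μ g t < ‖g x‖ₑ} : Set Ω) := by
    filter_upwards [AEEqFun.coeFn_add f g] with x hx (hx' : _ < ‖(f + g) x‖ₑ)
    rw [hx, Pi.add_apply] at hx'
    by_contra hcon
    have h1 : ¬ (rearr μ f t < ‖f x‖ₑ ∨ rearr μ g t < ‖g x‖ₑ) := hcon
    rw [not_or, not_lt, not_lt] at h1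
    exact absurd (hx'.trans_le (enorm_add_le _ _)) (not_lt.2 (add_le_add h1.1 h1.2))
  calc μ {x | rearr μ f t + rearr μ g t < ‖(f + g) x‖ₑ}
      ≤ μ ({x | rearr μ f t < ‖f x‖ₑ} ∪ {x | rearr μ g t < ‖g x‖ₑ}) := measure_mono_ae hsub
    _ ≤ ENNReal.ofReal t + ENNReal.ofReal t := (measure_union_le _ _).trans
        (add_le_add (measure_rearr_lt_le f t) (measure_rearr_lt_le g t))
    _ = ENNReal.ofReal (2 * t) := by rw [← ENNReal.ofReal_add ht ht, two_mul]

/-- Splitting a function at the level `f^*(s)`. -/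
theorem exists_truncation (f : Ω →ₘ[μ] ℂ) (s : ℝ) :
    ∃ f₀ f₁ : Ω →ₘ[μ] ℂ, f = f₀ + f₁ ∧ (∀ u, rearr μ f₀ u ≤ rearr μ f u) ∧
      (∀ u, s ≤ u → rearr μ f₀ u = 0) ∧ (∀ u, rearr μ f₁ u ≤ rearr μ f u) ∧
      ∀ u, rearr μ f₁ u ≤ rearr μ f s := by
  set l := rearr μ f s with hl
  have hA : MeasurableSet {z : ℂ | l < ‖z‖ₑ} := measurableSet_lt measurable_const measurable_enorm
  have hm0 : Measurable ({z : ℂ | l < ‖z‖ₑ}.indicator id) := measurable_id.indicator hA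
  have hm1 : Measurable ({z : ℂ | l < ‖z‖ₑ}ᶜ.indicator id) := measurable_id.indicator hA.compl
  have h0 := AEEqFun.coeFn_compMeasurable _ hm0 f
  have h1 := AEEqFun.coeFn_compMeasurable _ hm1 f
  set f₀ := AEEqFun.compMeasurable _ hm0 f
  set f₁ := AEEqFun.compMeasurable _ hm1 f
  refine ⟨f₀, f₁, ?_, fun u => rearr_mono ?_ u, fun u hu => ?_, fun u => rearr_mono ?_ u,
    fun u => rearr_le_of_ae_le ?_ u⟩
  · refine AEEqFun.ext ?_
    filter_upwards [h0, h1, AEEqFun.coeFn_add f₀ f₁] with x a b c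
    rw [c, Pi.add_apply, a, b, Function.comp_apply, Function.comp_apply,
      indicator_self_add_compl_apply]
    rfl
  · filter_upwards [h0] with x a
    rw [a, Function.comp_apply]
    exact enorm_indicator_le_enorm_self _ _
  -- `f₀` lives on `{|f| > f^*(s)}`, a set of measure at most `s`, so the level `0` is admissible
  -- for every `u ≥ s`.
  · refine le_antisymm (sInf_le ?_) bot_le
    refine ((measure_mono_ae ?_).trans (measure_rearr_lt_le f s)).trans
      (ENNReal.ofReal_le_ofReal hu)
    filter_upwards [h0] with x a (hx : 0 < ‖f₀ x‖ₑ)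
    rw [a, Function.comp_apply] at hx
    by_contra hcon
    have : f x ∉ {z : ℂ | l < ‖z‖ₑ} := hcon
    simp [indicator_of_notMem this] at hx
  · filter_upwards [h1] with x a
    rw [a, Function.comp_apply]
    exact enorm_indicator_le_enorm_self _ _
  · filter_upwards [h1] with x a
    rw [a, Function.comp_apply]
    by_cases hx : f x ∈ {z : ℂ | l < ‖z‖ₑ}ᶜ
    · rw [indicator_of_mem hx]
      exact not_lt.1 hx
    · simp [indicator_of_notMem hx]

end Rearrangement

/-! ### Estimates in Lorentz spaces -/

theorem setLIntegral_Ioo_rpow {r s : ℝ} (hr : 0 < r) (hs : 0 < s) :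
    ∫⁻ u in Ioo 0 s, ENNReal.ofReal (u ^ (r - 1)) = ENNReal.ofReal (s ^ r / r) := by
  rw [setLIntegral_congr Ioo_ae_eq_Ioc]
  have hint : IntervalIntegrable (fun u : ℝ => u ^ (r - 1)) volume 0 s :=
    intervalIntegral.intervalIntegrable_rpow' (by linarith)
  rw [← ofReal_integral_eq_lintegral_ofReal ((intervalIntegrable_iff_integrableOn_Ioc_of_le
    hs.le).1 hint), ← intervalIntegral.integral_of_le hs.le, integral_rpow (Or.inl (by linarith)),
    sub_add_cancel, Real.zero_rpow hr.ne', sub_zero]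
  filter_upwards [ae_restrict_mem measurableSet_Ioc] with u hu
  exact Real.rpow_nonneg hu.1.le _

theorem setLIntegral_Ici_rpow {r s : ℝ} (hr : 0 < r) (hs : 0 < s) :
    ∫⁻ u in Ici s, ENNReal.ofReal (u ^ (-r - 1)) = ENNReal.ofReal (s ^ (-r) / r) := by
  rw [← setLIntegral_congr Ioi_ae_eq_Ici,
    ← ofReal_integral_eq_lintegral_ofReal (integrableOn_Ioi_rpow_of_lt (by linarith) hs),
    integral_Ioi_rpow_of_lt (by linarith) hs, sub_add_cancel, neg_div_neg_eq]
  filter_upwards [ae_restrict_mem measurableSet_Ioi] with u (hu : s < u)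
  exact Real.rpow_nonneg (hs.trans hu).le _

section Lorentz

variable {Ω : Type*} [MeasurableSpace Ω] {μ : Measure Ω}

/-- The Lorentz quasi-norm of a function whose rearrangement is dominated by
`B (u / s) ^ (-α)` to the left and by `B (u / s) ^ (-β)` to the right of `s`. -/
theorem lorentzNorm_le (μ : Measure Ω) {p q : ℝ≥0∞} {α β : ℝ} (hq : 0 < q)
    (hα : α < p⁻¹.toReal) (hβ : p⁻¹.toReal < β) :
    ∃ c : ℝ≥0, ∀ (f : Ω →ₘ[μ] ℂ) (s : ℝ) (B : ℝ≥0∞), 0 < s →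
      (∀ u, 0 < u → u < s → rearr μ f u ≤ ENNReal.ofReal ((u / s) ^ (-α)) * B) →
      (∀ u, s ≤ u → rearr μ f u ≤ ENNReal.ofReal ((u / s) ^ (-β)) * B) →
      lorentzNorm μ p q f ≤ c * (ENNReal.ofReal (s ^ p⁻¹.toReal) * B) := by
  set x := p⁻¹.toReal with hx
  rcases eq_or_ne q ∞ with hqt | hqt
  · refine ⟨1, fun f s B hs h1 h2 => ?_⟩
    rw [lorentzNorm, if_pos hqt, ← hx, ENNReal.coe_one, one_mul]
    refine iSup₂_le fun t ht => ?_
    have hv : 0 < t / s := div_pos ht hs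
    have key : ∀ γ : ℝ, (t / s) ^ (x - γ) ≤ 1 →
        rearr μ f t ≤ ENNReal.ofReal ((t / s) ^ (-γ)) * B →
        ENNReal.ofReal (t ^ x) * rearr μ f t ≤ ENNReal.ofReal (s ^ x) * B := by
      intro γ hγ hle
      calc ENNReal.ofReal (t ^ x) * rearr μ f t
          ≤ ENNReal.ofReal (t ^ x) * (ENNReal.ofReal ((t / s) ^ (-γ)) * B) := by gcongr
        _ = ENNReal.ofReal (t ^ x * (t / s) ^ (-γ)) * B := by
            rw [ENNReal.ofReal_mul (by positivity), mul_assoc]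
        _ ≤ ENNReal.ofReal (s ^ x) * B := by
            gcongr
            have : t ^ x = s ^ x * (t / s) ^ x := by
              rw [← Real.mul_rpow hs.le hv.le, mul_div_cancel₀ _ hs.ne']
            rw [this, mul_assoc, ← Real.rpow_add hv, ← sub_eq_add_neg]
            exact mul_le_of_le_one_right (by positivity) hγ
    rcases lt_or_ge t s with hts | hts
    · exact key α (Real.rpow_le_one hv.le ((div_le_one hs).2 hts.le) (by linarith)) (h1 t ht hts)
    · exact key β (Real.rpow_le_one_of_one_le_of_nonpos ((one_le_div hs).2 hts) (by linarith))
        (h2 t hts)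
  · set Q := q.toReal with hQ
    have hQ0 : 0 < Q := ENNReal.toReal_pos hq.ne' hqt
    have hy : q⁻¹.toReal = 1 / Q := by rw [ENNReal.toReal_inv, one_div]
    -- The integrals of `u^((x-α)Q-1)` over `(0, 1)` and of `u^((x-β)Q-1)` over `[1, ∞)`; scaling
    -- reduces general `s` to `s = 1`.
    set κ : ℝ := 1 / ((x - α) * Q) + 1 / ((β - x) * Q) with hκ
    have hα' : 0 < (x - α) * Q := mul_pos (by linarith) hQ0
    have hβ' : 0 < (β - x) * Q := mul_pos (by linarith) hQ0
    have hκ0 : 0 < κ := by positivity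
    refine ⟨Real.toNNReal (κ ^ (1 / Q)), fun f s B hs h1 h2 => ?_⟩
    rw [lorentzNorm, if_neg hqt, ← hx, hy, ← hQ]
    have key : ∀ (γ u : ℝ), 0 < u → rearr μ f u ≤ ENNReal.ofReal ((u / s) ^ (-γ)) * B →
        (ENNReal.ofReal (u ^ (x - 1 / Q)) * rearr μ f u) ^ Q ≤
          (ENNReal.ofReal (s ^ (γ * Q)) * B ^ Q) * ENNReal.ofReal (u ^ ((x - γ) * Q - 1)) := by
      intro γ u hu hle
      have e : (u ^ (x - 1 / Q) * (u / s) ^ (-γ)) ^ Q = s ^ (γ * Q) * u ^ ((x - γ) * Q - 1) := by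
        rw [Real.div_rpow hu.le hs.le, Real.rpow_neg hs.le, div_inv_eq_mul, ← mul_assoc,
          ← Real.rpow_add hu, Real.mul_rpow (by positivity) (by positivity),
          ← Real.rpow_mul hu.le, ← Real.rpow_mul hs.le, mul_comm]
        congr 2
        field_simp
        ring
      calc (ENNReal.ofReal (u ^ (x - 1 / Q)) * rearr μ f u) ^ Q
          ≤ (ENNReal.ofReal (u ^ (x - 1 / Q)) * (ENNReal.ofReal ((u / s) ^ (-γ)) * B)) ^ Q := by
            gcongr
        _ = ENNReal.ofReal ((u ^ (x - 1 / Q) * (u / s) ^ (-γ)) ^ Q) * B ^ Q := by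
            rw [← mul_assoc, ← ENNReal.ofReal_mul (by positivity),
              ENNReal.mul_rpow_of_nonneg _ _ hQ0.le, ENNReal.ofReal_rpow_of_pos (by positivity)]
        _ = _ := by
            rw [e, ENNReal.ofReal_mul (by positivity)]
            ring
    have hA : ∫⁻ t in Ioo 0 s, (ENNReal.ofReal (t ^ (x - 1 / Q)) * rearr μ f t) ^ Q ≤
        ENNReal.ofReal (s ^ (x * Q)) * B ^ Q * ENNReal.ofReal (1 / ((x - α) * Q)) := by
      calc _ ≤ ∫⁻ u in Ioo 0 s, (ENNReal.ofReal (s ^ (α * Q)) * B ^ Q) *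
            ENNReal.ofReal (u ^ ((x - α) * Q - 1)) :=
            setLIntegral_mono' measurableSet_Ioo fun u hu => key α u hu.1 (h1 u hu.1 hu.2)
        _ = (ENNReal.ofReal (s ^ (α * Q)) * B ^ Q) *
            ENNReal.ofReal (s ^ ((x - α) * Q) / ((x - α) * Q)) := by
            rw [lintegral_const_mul _ (by fun_prop), setLIntegral_Ioo_rpow hα' hs]
        _ = _ := by
            have : s ^ (x * Q) = s ^ (α * Q) * s ^ ((x - α) * Q) := by
              rw [← Real.rpow_add hs]; congr 1; ring
            rw [this, ENNReal.ofReal_mul (by positivity), div_eq_mul_one_div,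
              ENNReal.ofReal_mul (by positivity)]
            ring
    have hB : ∫⁻ t in Ici s, (ENNReal.ofReal (t ^ (x - 1 / Q)) * rearr μ f t) ^ Q ≤
        ENNReal.ofReal (s ^ (x * Q)) * B ^ Q * ENNReal.ofReal (1 / ((β - x) * Q)) := by
      calc _ ≤ ∫⁻ u in Ici s, (ENNReal.ofReal (s ^ (β * Q)) * B ^ Q) *
            ENNReal.ofReal (u ^ (-((β - x) * Q) - 1)) :=
            setLIntegral_mono' measurableSet_Ici fun u (hu : s ≤ u) => by
              have := key β u (hs.trans_le hu) (h2 u hu)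
              rwa [show (x - β) * Q = -((β - x) * Q) by ring] at this
        _ = (ENNReal.ofReal (s ^ (β * Q)) * B ^ Q) *
            ENNReal.ofReal (s ^ (-((β - x) * Q)) / ((β - x) * Q)) := by
            rw [lintegral_const_mul _ (by fun_prop), setLIntegral_Ici_rpow hβ' hs]
        _ = _ := by
            have : s ^ (x * Q) = s ^ (β * Q) * s ^ (-((β - x) * Q)) := by
              rw [← Real.rpow_add hs]; congr 1; ring
            rw [this, ENNReal.ofReal_mul (by positivity), div_eq_mul_one_div,
              ENNReal.ofReal_mul (by positivity)]
            ring
    have htot : ∫⁻ t in Ioi 0, (ENNReal.ofReal (t ^ (x - 1 / Q)) * rearr μ f t) ^ Q ≤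
        ENNReal.ofReal (s ^ (x * Q)) * B ^ Q * ENNReal.ofReal κ := by
      rw [← Ioo_union_Ici_eq_Ioi hs, hκ, ENNReal.ofReal_add (by positivity) (by positivity),
        mul_add]
      exact (lintegral_union_le _ _ _).trans (add_le_add hA hB)
    calc _ ≤ (ENNReal.ofReal (s ^ (x * Q)) * B ^ Q * ENNReal.ofReal κ) ^ (1 / Q) := by gcongr
      _ = _ := by
        rw [ENNReal.mul_rpow_of_nonneg _ _ (by positivity),
          ENNReal.mul_rpow_of_nonneg _ _ (by positivity), ← ENNReal.rpow_mul,
          mul_one_div_cancel hQ0.ne', ENNReal.rpow_one, ENNReal.ofReal_rpow_of_pos (by positivity),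
          ENNReal.ofReal_rpow_of_pos hκ0, ← Real.rpow_mul hs.le, mul_assoc x,
          mul_one_div_cancel hQ0.ne', mul_one, mul_comm]
        rfl

/-- The embedding of a Lorentz space into the corresponding weak space. -/
theorem rearr_le_lorentzNorm (μ : Measure Ω) {p q : ℝ≥0∞} (hq : 0 < q)
    (hpq : 0 < p⁻¹.toReal ∨ q = ∞) :
    ∃ c : ℝ≥0, ∀ (f : Ω →ₘ[μ] ℂ) (s : ℝ), 0 < s →
      rearr μ f s ≤ c * (ENNReal.ofReal (s ^ (-p⁻¹.toReal)) * lorentzNorm μ p q f) := by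
  set x := p⁻¹.toReal with hx
  have cancel : ∀ (κ : ℝ), 0 < κ → ∀ (s : ℝ), 0 < s → ∀ R L : ℝ≥0∞,
      ENNReal.ofReal (κ * s ^ x) * R ≤ L →
      R ≤ (Real.toNNReal κ⁻¹ : ℝ≥0) * (ENNReal.ofReal (s ^ (-x)) * L) := by
    intro κ hκ s hs R L h
    calc R = ENNReal.ofReal (κ⁻¹ * s ^ (-x) * (κ * s ^ x)) * R := by
          have : κ⁻¹ * s ^ (-x) * (κ * s ^ x) = 1 := by
            rw [Real.rpow_neg hs.le]
            field_simp
          rw [this, ENNReal.ofReal_one, one_mul]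
      _ = ENNReal.ofReal κ⁻¹ * (ENNReal.ofReal (s ^ (-x)) * (ENNReal.ofReal (κ * s ^ x) * R)) := by
          rw [ENNReal.ofReal_mul (by positivity), ENNReal.ofReal_mul (by positivity), mul_assoc,
            mul_assoc]
      _ ≤ _ := by
          change _ ≤ ENNReal.ofReal κ⁻¹ * _
          gcongr
  rcases eq_or_ne q ∞ with hqt | hqt
  · refine ⟨_, fun f s hs => cancel 1 one_pos s hs _ _ ?_⟩
    rw [lorentzNorm, if_pos hqt, ← hx, one_mul]
    exact le_iSup₂ (f := fun (t : ℝ) (_ : 0 < t) => ENNReal.ofReal (t ^ x) * rearr μ f t) s hs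
  · have hx0 : 0 < x := hpq.resolve_right hqt
    set Q := q.toReal with hQ
    have hQ0 : 0 < Q := ENNReal.toReal_pos hq.ne' hqt
    have hy : q⁻¹.toReal = 1 / Q := by rw [ENNReal.toReal_inv, one_div]
    have hxQ : 0 < x * Q := by positivity
    refine ⟨_, fun f s hs => cancel ((x * Q)⁻¹ ^ (1 / Q)) (by positivity) s hs _ _ ?_⟩
    rw [lorentzNorm, if_neg hqt, ← hx, hy, ← hQ]
    -- Only `(0, s)` is kept, where `f^* ≥ f^*(s)`; the remaining power of `u` is integrable at the
    -- origin because `x > 0`.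
    have hle : ENNReal.ofReal (s ^ (x * Q) / (x * Q)) * rearr μ f s ^ Q ≤
        ∫⁻ t in Ioi 0, (ENNReal.ofReal (t ^ (x - 1 / Q)) * rearr μ f t) ^ Q := by
      calc _ = ∫⁻ u in Ioo 0 s, ENNReal.ofReal (u ^ (x * Q - 1)) * rearr μ f s ^ Q := by
            rw [lintegral_mul_const _ (by fun_prop), setLIntegral_Ioo_rpow hxQ hs]
        _ ≤ ∫⁻ t in Ioo 0 s, (ENNReal.ofReal (t ^ (x - 1 / Q)) * rearr μ f t) ^ Q := by
            refine setLIntegral_mono' measurableSet_Ioo fun u hu => ?_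
            have hu0 : 0 < u := hu.1
            rw [ENNReal.mul_rpow_of_nonneg _ _ hQ0.le, ENNReal.ofReal_rpow_of_pos (by positivity),
              ← Real.rpow_mul hu0.le, show (x - 1 / Q) * Q = x * Q - 1 by field_simp]
            gcongr
            exact rearr_antitone μ f hu.2.le
        _ ≤ _ := lintegral_mono_set Ioo_subset_Ioi_self
    calc _ = (ENNReal.ofReal (s ^ (x * Q) / (x * Q)) * rearr μ f s ^ Q) ^ (1 / Q) := by
          rw [ENNReal.mul_rpow_of_nonneg _ _ (by positivity), ← ENNReal.rpow_mul,
            mul_one_div_cancel hQ0.ne', ENNReal.rpow_one,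
            ENNReal.ofReal_rpow_of_pos (by positivity), div_eq_inv_mul (s ^ (x * Q)),
            Real.mul_rpow (by positivity) (by positivity), ← Real.rpow_mul hs.le, mul_assoc x,
            mul_one_div_cancel hQ0.ne', mul_one]
      _ ≤ _ := by gcongr

end Lorentz

/-! ### The K-functional -/

theorem kFunctional_mono {V : Type*} [AddCommGroup V] (N₀ N₁ : V → ℝ≥0∞) (x : V) :
    Monotone fun t => kFunctional N₀ N₁ t x := fun s t hst => by
  exact iInf_mono fun x₀ => iInf_mono fun x₁ => iInf_mono fun _ => by gcongr

theorem mem_sumSpace_of_kFunctional_lt_top {V : Type*} [AddCommGroup V] {N₀ N₁ : V → ℝ≥0∞} {x : V}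
    {t : ℝ} (ht : 0 < t) (h : kFunctional N₀ N₁ t x < ∞) : x ∈ sumSpace N₀ N₁ := by
  simp only [kFunctional, iInf_lt_iff] at h
  obtain ⟨x₀, x₁, hx, hlt⟩ := h
  obtain ⟨h0, h1⟩ := ENNReal.add_lt_top.1 hlt
  refine ⟨x₀, x₁, h0, ?_, hx⟩
  by_contra hN
  rw [not_lt_top_iff.1 hN, ENNReal.mul_top (by simpa using ht)] at h1
  exact lt_irrefl _ h1

/-- The relation `1/Θ = a - b` makes `s^(1/Θ) s^b = s^a`, so both pieces of the decomposition scale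
alike and the prefactor `s^(-a)` cancels. -/
theorem mul_kFunctional_le {V : Type*} [AddCommGroup V] {N₀ N₁ : V → ℝ≥0∞} {x x₀ x₁ : V}
    (hx : x = x₀ + x₁) {s a b Θ : ℝ} (hs : 0 < s) (hΘ : 1 / Θ = a - b) {c₀ c₁ : ℝ≥0} {B : ℝ≥0∞}
    (h₀ : N₀ x₀ ≤ c₀ * (ENNReal.ofReal (s ^ a) * B))
    (h₁ : N₁ x₁ ≤ c₁ * (ENNReal.ofReal (s ^ b) * B)) :
    ENNReal.ofReal (s ^ (-a)) * kFunctional N₀ N₁ (s ^ (1 / Θ)) x ≤ (c₀ + c₁ : ℝ≥0) * B := by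
  have e1 : ENNReal.ofReal (s ^ (-a)) * ENNReal.ofReal (s ^ a) = 1 := by
    rw [← ENNReal.ofReal_mul (by positivity), ← Real.rpow_add hs, neg_add_cancel, Real.rpow_zero,
      ENNReal.ofReal_one]
  have e2 : ENNReal.ofReal (s ^ (1 / Θ)) * ENNReal.ofReal (s ^ b) = ENNReal.ofReal (s ^ a) := by
    rw [← ENNReal.ofReal_mul (by positivity), ← Real.rpow_add hs, hΘ, sub_add_cancel]
  calc _ ≤ ENNReal.ofReal (s ^ (-a)) * (c₀ * (ENNReal.ofReal (s ^ a) * B) +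
        ENNReal.ofReal (s ^ (1 / Θ)) * (c₁ * (ENNReal.ofReal (s ^ b) * B))) := by
        gcongr
        exact (iInf_le_of_le x₀ <| iInf₂_le_of_le x₁ hx le_rfl).trans
          (add_le_add h₀ (mul_le_mul_right h₁ _))
    _ = ENNReal.ofReal (s ^ (-a)) * (c₀ * (ENNReal.ofReal (s ^ a) * B) +
        c₁ * ((ENNReal.ofReal (s ^ (1 / Θ)) * ENNReal.ofReal (s ^ b)) * B)) := by ring
    _ = (ENNReal.ofReal (s ^ (-a)) * ENNReal.ofReal (s ^ a)) * ((c₀ + c₁) * B) := by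
        rw [e2]; ring
    _ = _ := by rw [e1, one_mul, ENNReal.coe_add]

theorem rearr_two_mul_le_kFunctional {Ω : Type*} [MeasurableSpace Ω] {μ : Measure Ω}
    {N₀ N₁ : (Ω →ₘ[μ] ℂ) → ℝ≥0∞} {a b Θ : ℝ} (hΘ : 1 / Θ = a - b) {c₀ c₁ : ℝ≥0} {s : ℝ}
    (hs : 0 < s) (h₀ : ∀ f, rearr μ f s ≤ c₀ * (ENNReal.ofReal (s ^ (-a)) * N₀ f))
    (h₁ : ∀ f, rearr μ f s ≤ c₁ * (ENNReal.ofReal (s ^ (-b)) * N₁ f)) (f : Ω →ₘ[μ] ℂ) :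
    rearr μ f (2 * s) ≤
      (c₀ + c₁ + 1 : ℝ≥0) * (ENNReal.ofReal (s ^ (-a)) * kFunctional N₀ N₁ (s ^ (1 / Θ)) f) := by
  have e : ENNReal.ofReal (s ^ (-b)) =
      ENNReal.ofReal (s ^ (-a)) * ENNReal.ofReal (s ^ (1 / Θ)) := by
    rw [← ENNReal.ofReal_mul (by positivity), ← Real.rpow_add hs, hΘ]
    congr 2; ring
  -- The summand `1` keeps the constant nonzero, so that multiplication by it commutes with the
  -- infimum over decompositions.
  have hne : ((c₀ + c₁ + 1 : ℝ≥0) : ℝ≥0∞) * ENNReal.ofReal (s ^ (-a)) ≠ 0 :=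
    mul_ne_zero (by simp) (by simpa using Real.rpow_pos_of_pos hs _)
  have hfin : ((c₀ + c₁ + 1 : ℝ≥0) : ℝ≥0∞) * ENNReal.ofReal (s ^ (-a)) ≠ ∞ :=
    ENNReal.mul_ne_top ENNReal.coe_ne_top ENNReal.ofReal_ne_top
  rw [← mul_assoc, kFunctional]
  simp only [ENNReal.mul_iInf_of_ne hne hfin]
  refine le_iInf fun f₀ => le_iInf₂ fun f₁ hf => ?_
  have hc₀ : c₀ ≤ c₀ + c₁ + 1 := by rw [add_assoc]; exact le_self_add
  have hc₁ : c₁ ≤ c₀ + c₁ + 1 := le_add_left le_rfl |>.trans le_self_add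
  calc rearr μ f (2 * s) ≤ rearr μ f₀ s + rearr μ f₁ s := by
        rw [hf]; exact rearr_add_le f₀ f₁ hs.le
    _ ≤ (c₀ + c₁ + 1 : ℝ≥0) * (ENNReal.ofReal (s ^ (-a)) * N₀ f₀) +
        (c₀ + c₁ + 1 : ℝ≥0) * (ENNReal.ofReal (s ^ (-b)) * N₁ f₁) :=
        add_le_add ((h₀ f₀).trans (by gcongr)) ((h₁ f₁).trans (by gcongr))
    _ = _ := by rw [e]; ring

/-! ### The interpolation theorem -/

theorem exists_dilationNorm_le_of_lt_lowerBoyd {ρ : MHalfLine → ℝ≥0∞} {r : ℝ} (hr : 0 < r)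
    (h : ENNReal.ofReal r < lowerBoyd ρ) : ∃ p c : ℝ, 0 < p ∧ 1 / p < 1 / r ∧ 0 < c ∧
      ∀ (a : ℝ) (ha : 0 < a), a < 1 →
        dilationNorm ρ ha ≤ ENNReal.ofReal (c * a ^ (-(1 / p))) := by
  obtain ⟨_, ⟨p, hp, rfl, c, hc, hD⟩, hlt⟩ := lt_sSup_iff.1 h
  exact ⟨p, c, hp, one_div_lt_one_div_of_lt hr ((ENNReal.ofReal_lt_ofReal_iff hp).1 hlt), hc, hD⟩

theorem exists_dilationNorm_le_of_upperBoyd_lt {ρ : MHalfLine → ℝ≥0∞} {r : ℝ≥0∞} (hr : r ≠ ∞)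
    (h : upperBoyd ρ < r) : ∃ q c : ℝ, r⁻¹.toReal < 1 / q ∧ 0 < c ∧
      ∀ (a : ℝ) (ha : 0 < a), 1 ≤ a →
        dilationNorm ρ ha ≤ ENNReal.ofReal (c * a ^ (-(1 / q))) := by
  obtain ⟨_, ⟨q, hq, rfl, c, hc, hD⟩, hlt⟩ := sInf_lt_iff.1 h
  refine ⟨q, c, ?_, hc, hD⟩
  rw [ENNReal.toReal_inv, ← one_div]
  exact one_div_lt_one_div_of_lt hq ((ENNReal.ofReal_lt_iff_lt_toReal hq.le hr).1 hlt)

/-- The K-functional of a couple of Lorentz spaces is controlled by an operator that is bounded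
on the space. -/
theorem exists_kFunctional_majorant {Ω : Type*} [MeasurableSpace Ω] {μ : Measure Ω}
    {ρ : MHalfLine → ℝ≥0∞} (hE : IsRIQuasiBanach μ ρ) {p₀ Θ : ℝ} {p₁ q₀ q₁ : ℝ≥0∞}
    (hp₀ : 0 < p₀) (hq₀ : 0 < q₀) (hq₁ : 0 < q₁) (hpE : ENNReal.ofReal p₀ < lowerBoyd ρ)
    (hΘ : 1 / Θ = 1 / p₀ - p₁⁻¹.toReal)
    (hcase : (upperBoyd ρ < p₁ ∧ p₁ < ∞) ∨ (p₁ = ∞ ∧ q₁ = ∞)) :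
    ∃ M C : ℝ≥0, ∀ f ∈ riSpace μ ρ, ∃ U : ℝ → ℝ≥0∞, Measurable U ∧
      evalNonneg ρ U ≤ M * riNorm μ ρ f ∧ ∀ t : ℝ, 0 < t →
        ENNReal.ofReal (t ^ (-(1 / p₀))) * kFunctional (lorentzNorm μ (ENNReal.ofReal p₀) q₀)
          (lorentzNorm μ p₁ q₁) (t ^ (1 / Θ)) f ≤ C * U t := by
  obtain ⟨p, c, hp, hpp₀, hc, hD⟩ := exists_dilationNorm_le_of_lt_lowerBoyd hp₀ hpE
  obtain ⟨α, hα1, hα2⟩ := exists_between hpp₀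
  have hα0 : 0 ≤ α := (one_div_pos.2 hp).le.trans hα1.le
  have hx₀ : (ENNReal.ofReal p₀)⁻¹.toReal = 1 / p₀ := by
    rw [ENNReal.toReal_inv, ENNReal.toReal_ofReal hp₀.le, one_div]
  obtain ⟨M₀, hM₀⟩ := hE.exists_majorant_left hc hα0 hα1 hD
  -- Any exponent above `1/p₀` serves on the right, since the rearrangement of the large part
  -- vanishes there.
  obtain ⟨c₀, hc₀⟩ := lorentzNorm_le μ (p := ENNReal.ofReal p₀) (α := α) (β := 1 / p₀ + 1) hq₀
    (by rw [hx₀]; exact hα2) (by rw [hx₀]; linarith)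
  rw [hx₀] at hc₀
  rcases hcase with ⟨hqE, hp₁⟩ | ⟨rfl, rfl⟩
  · obtain ⟨q, d, hqp, hd, hDq⟩ := exists_dilationNorm_le_of_upperBoyd_lt hp₁.ne hqE
    obtain ⟨β, hβ1, hβ2⟩ := exists_between hqp
    have hβ0 : 0 ≤ β := ENNReal.toReal_nonneg.trans hβ1.le
    obtain ⟨M₁, hM₁⟩ := hE.exists_majorant_right hd hβ0 hβ2 hDq
    have hx₁ : 0 < p₁⁻¹.toReal := ENNReal.toReal_pos (ENNReal.inv_ne_zero.2 hp₁.ne)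
      (ENNReal.inv_ne_top.2 (ne_bot_of_gt hqE))
    -- `α = 0` suits the small part, bounded on the left by the constant `f^*(t)`; this requires
    -- `1/p₁ > 0`.
    obtain ⟨c₁, hc₁⟩ := lorentzNorm_le μ (p := p₁) (α := 0) (β := β) hq₁ hx₁ hβ1
    obtain ⟨K, -, hK⟩ := hE.exists_eval_add_le
    refine ⟨K * (M₀ + M₁), c₀ + c₁, fun f hf => ?_⟩
    obtain ⟨U₀, hU₀m, hU₀, hfU₀⟩ := hM₀ _ (rearr_antitone μ f) hf
    obtain ⟨U₁, hU₁m, hU₁, hfU₁⟩ := hM₁ _ (rearr_antitone μ f) hf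
    refine ⟨fun t => U₀ t + U₁ t, hU₀m.add hU₁m, ?_, fun t ht => ?_⟩
    · calc _ ≤ (K : ℝ≥0∞) * (evalNonneg ρ U₀ + evalNonneg ρ U₁) := hK _ _ hU₀m hU₁m
        _ ≤ K * (M₀ * riNorm μ ρ f + M₁ * riNorm μ ρ f) := by gcongr; exacts [hU₀, hU₁]
        _ = _ := by push_cast; ring
    · obtain ⟨f₀, f₁, hfeq, h0le, h0z, h1le, h1s⟩ := exists_truncation f t
      refine mul_kFunctional_le hfeq ht hΘ (hc₀ f₀ t _ ht ?_ ?_) (hc₁ f₁ t _ ht ?_ ?_)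
      · intro u hu hut
        refine ((h0le u).trans (hfU₀ t u hu hut.le)).trans ?_
        gcongr
        exact le_self_add
      · intro u hu
        rw [h0z u hu]
        exact bot_le
      · intro u hu hut
        have h2 := hfU₁ t t ht le_rfl
        rw [div_self ht.ne', Real.one_rpow, ENNReal.ofReal_one, one_mul] at h2
        rw [neg_zero, Real.rpow_zero, ENNReal.ofReal_one, one_mul]
        exact (h1s u).trans (h2.trans le_add_self)
      · intro u hu
        refine ((h1le u).trans (hfU₁ t u ht hu)).trans ?_
        gcongr
        exact le_add_self
  · refine ⟨M₀, c₀ + 1, fun f hf => ?_⟩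
    obtain ⟨U₀, hU₀m, hU₀, hfU₀⟩ := hM₀ _ (rearr_antitone μ f) hf
    refine ⟨U₀, hU₀m, hU₀, fun t ht => ?_⟩
    obtain ⟨f₀, f₁, hfeq, h0le, h0z, h1le, h1s⟩ := exists_truncation f t
    refine mul_kFunctional_le hfeq ht hΘ (hc₀ f₀ t _ ht ?_ ?_) ?_
    · exact fun u hu hut => (h0le u).trans (hfU₀ t u hu hut.le)
    · intro u hu
      rw [h0z u hu]
      exact bot_le
    -- For `p₁ = q₁ = ∞` the second quasi-norm is the supremum of `f₁^*`, at most `f^*(t) ≤ U₀(t)`,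
    -- so no bound to the right of `t`, and no upper Boyd index, enters.
    · have h2 := hfU₀ t t ht le_rfl
      rw [div_self ht.ne', Real.one_rpow, ENNReal.ofReal_one, one_mul] at h2
      rw [lorentzNorm, if_pos rfl]
      simp only [ENNReal.inv_top, ENNReal.toReal_zero, Real.rpow_zero, ENNReal.ofReal_one, one_mul,
        ENNReal.coe_one]
      exact iSup₂_le fun u _ => (h1s u).trans h2

/-- A lower Boyd index above `r > 0` bounds the dilation by `1/2`, which is applied to `t ↦ g (2 t)`
to recover `g`. -/
theorem IsRIQuasiBanach.exists_eval_half_le {Ω : Type*} [MeasurableSpace Ω] {μ : Measure Ω}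
    {ρ : MHalfLine → ℝ≥0∞} (hE : IsRIQuasiBanach μ ρ) {r : ℝ} (hr : 0 < r)
    (hpE : ENNReal.ofReal r < lowerBoyd ρ) :
    ∃ C : ℝ≥0, ∀ g : ℝ → ℝ≥0∞, Antitone g → evalNonneg ρ (fun t => g (2 * t)) < ∞ →
      evalNonneg ρ g ≤ C * evalNonneg ρ (fun t => g (2 * t)) := by
  obtain ⟨p, c, hp, -, hc, hD⟩ := exists_dilationNorm_le_of_lt_lowerBoyd hr hpE
  have hlt := (hD (1 / 2) one_half_pos one_half_lt_one).trans_lt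
    (ENNReal.ofReal_lt_ofReal_iff_of_nonneg (by positivity) |>.2 (lt_add_one _))
  refine ⟨Real.toNNReal (c * (1 / 2) ^ (-(1 / p)) + 1), fun g hg hfin => ?_⟩
  have h := hE.eval_dilation_le (g := fun t => g (2 * t))
    (fun x y hxy => hg (mul_le_mul_of_nonneg_left hxy zero_le_two)) hfin one_half_pos hlt
  have e : (fun t => g (2 * (1 / 2 * t))) = g := by
    funext t
    congr 1
    ring
  rwa [e] at h

theorem theorem15 {Ω : Type*} [MeasurableSpace Ω] (μ : Measure Ω) [SigmaFinite μ]
    (hatom : NonAtomic μ) (hμ : μ univ = ∞)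
    (ρ : MHalfLine → ℝ≥0∞) (hE : IsRIQuasiBanach μ ρ)
    (p₀ Θ : ℝ) (p₁ q₀ q₁ : ℝ≥0∞)
    (hp₀ : 0 < p₀) (hp : ENNReal.ofReal p₀ < p₁) (hq₀ : 0 < q₀) (hq₁ : 0 < q₁)
    (hpE : ENNReal.ofReal p₀ < lowerBoyd ρ)
    (hcase : (upperBoyd ρ < p₁ ∧ p₁ < ∞ ∧ 1 / Θ = 1 / p₀ - 1 / p₁.toReal) ∨
      (p₁ = ∞ ∧ q₁ = ∞ ∧ Θ = p₀)) :
    hoSpace ρ Θ p₀ (lorentzNorm μ (ENNReal.ofReal p₀) q₀) (lorentzNorm μ p₁ q₁) = riSpace μ ρ ∧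
    ∃ C : ℝ≥0, ∀ f ∈ riSpace μ ρ,
      hoNorm ρ Θ p₀ (lorentzNorm μ (ENNReal.ofReal p₀) q₀) (lorentzNorm μ p₁ q₁) f
          ≤ C * riNorm μ ρ f ∧
      riNorm μ ρ f
          ≤ C * hoNorm ρ Θ p₀ (lorentzNorm μ (ENNReal.ofReal p₀) q₀) (lorentzNorm μ p₁ q₁) f := by
  have hx₀ : (ENNReal.ofReal p₀)⁻¹.toReal = 1 / p₀ := by
    rw [ENNReal.toReal_inv, ENNReal.toReal_ofReal hp₀.le, one_div]
  have hΘ : 1 / Θ = 1 / p₀ - p₁⁻¹.toReal := by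
    rcases hcase with ⟨-, -, h⟩ | ⟨rfl, -, rfl⟩
    · rw [h, ENNReal.toReal_inv, one_div p₁.toReal]
    · simp
  have hweak : 0 < p₁⁻¹.toReal ∨ q₁ = ∞ := by
    rcases hcase with ⟨h1, h2, -⟩ | ⟨-, h, -⟩
    · exact Or.inl (ENNReal.toReal_pos (ENNReal.inv_ne_zero.2 h2.ne)
        (ENNReal.inv_ne_top.2 (ne_bot_of_gt h1)))
    · exact Or.inr h
  set N₀ := lorentzNorm μ (ENNReal.ofReal p₀) q₀ with hN₀
  set N₁ := lorentzNorm μ p₁ q₁ with hN₁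
  have hkm : ∀ f, Measurable fun t : ℝ =>
      ENNReal.ofReal (t ^ (-(1 / p₀))) * kFunctional N₀ N₁ (t ^ (1 / Θ)) f := fun f =>
    Measurable.mul (by fun_prop)
      ((kFunctional_mono N₀ N₁ f).measurable.comp (measurable_id.pow_const _))
  have hpos : ∀ᵐ t ∂halfLine, 0 < t := ae_restrict_mem measurableSet_Ioi
  obtain ⟨M, C, hMC⟩ := exists_kFunctional_majorant hE hp₀ hq₀ hq₁ hpE hΘ
    (hcase.imp (fun h => ⟨h.1, h.2.1⟩) fun h => ⟨h.1, h.2.1⟩)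
  have hupper : ∀ f ∈ riSpace μ ρ, hoNorm ρ Θ p₀ N₀ N₁ f ≤ (C * M : ℝ≥0) * riNorm μ ρ f := by
    intro f hf
    obtain ⟨U, hUm, hU, hle⟩ := hMC f hf
    have hUfin : evalNonneg ρ U < ∞ := hU.trans_lt (ENNReal.mul_lt_top ENNReal.coe_lt_top hf)
    calc hoNorm ρ Θ p₀ N₀ N₁ f ≤ evalNonneg ρ (fun t => C * U t) :=
          hE.eval_mono (hkm f) (hpos.mono fun t ht => hle t ht)
      _ = C * evalNonneg ρ U := hE.eval_mul_le C hUfin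
      _ ≤ C * (M * riNorm μ ρ f) := by gcongr
      _ = _ := by rw [ENNReal.coe_mul, mul_assoc]
  obtain ⟨c₀, hc₀⟩ := rearr_le_lorentzNorm μ (p := ENNReal.ofReal p₀) hq₀
    (Or.inl (by rw [hx₀]; positivity))
  obtain ⟨c₁, hc₁⟩ := rearr_le_lorentzNorm μ hq₁ hweak
  rw [hx₀] at hc₀
  obtain ⟨H, hH⟩ := hE.exists_eval_half_le hp₀ hpE
  have hlower : ∀ f, hoNorm ρ Θ p₀ N₀ N₁ f < ∞ →
      riNorm μ ρ f ≤ (H * (c₀ + c₁ + 1) : ℝ≥0) * hoNorm ρ Θ p₀ N₀ N₁ f := by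
    intro f hf
    have h1 : evalNonneg ρ (fun t => rearr μ f (2 * t)) ≤
        (c₀ + c₁ + 1 : ℝ≥0) * hoNorm ρ Θ p₀ N₀ N₁ f := by
      rw [hoNorm, ← hE.eval_mul_le _ hf]
      refine hE.eval_mono ((rearr_antitone μ f).measurable.comp (measurable_const_mul 2))
        (hpos.mono fun t ht => ?_)
      exact rearr_two_mul_le_kFunctional hΘ ht (fun g => hc₀ g t ht) (fun g => hc₁ g t ht) f
    calc riNorm μ ρ f ≤ H * evalNonneg ρ (fun t => rearr μ f (2 * t)) :=
          hH _ (rearr_antitone μ f)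
            (h1.trans_lt (ENNReal.mul_lt_top ENNReal.coe_lt_top hf))
      _ ≤ H * ((c₀ + c₁ + 1 : ℝ≥0) * hoNorm ρ Θ p₀ N₀ N₁ f) := by gcongr
      _ = _ := by rw [ENNReal.coe_mul, mul_assoc]
  have hfin : ∀ f ∈ riSpace μ ρ, hoNorm ρ Θ p₀ N₀ N₁ f < ∞ := fun f hf =>
    (hupper f hf).trans_lt (ENNReal.mul_lt_top ENNReal.coe_lt_top hf)
  refine ⟨Subset.antisymm (fun f hf => ?_) fun f hf => ⟨?_, hfin f hf⟩,
    max (C * M) (H * (c₀ + c₁ + 1)), fun f hf => ⟨?_, ?_⟩⟩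
  · exact (hlower f hf.2).trans_lt (ENNReal.mul_lt_top ENNReal.coe_lt_top hf.2)
  -- A finite `hoNorm` makes the K-functional finite for a.e. `t`; one such `t > 0` already yields a
  -- decomposition in `X₀ + X₁`.
  · obtain ⟨F, hF⟩ := exists_of_evalNonneg_lt_top (hfin f hf)
    have hne : halfLine ≠ 0 := by
      rw [Ne, Measure.restrict_eq_zero, Real.volume_Ioi]
      exact ENNReal.top_ne_zero
    have : (ae halfLine).NeBot := ae_neBot.2 hne
    obtain ⟨t, ht, ht0⟩ := (hF.and hpos).exists
    refine mem_sumSpace_of_kFunctional_lt_top (Real.rpow_pos_of_pos ht0 (1 / Θ)) ?_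
    by_contra hK
    rw [not_lt_top_iff.1 hK, ENNReal.mul_top (by simpa using Real.rpow_pos_of_pos ht0 _)] at ht
    exact enorm_ne_top ht.symm
  · refine (hupper f hf).trans ?_
    gcongr
    exact le_max_left _ _
  · refine (hlower f (hfin f hf)).trans ?_
    gcongr
    exact le_max_right _ _
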